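/- Let $G$ be a (discrete) group and let $\mathcal C$ be a small category with an action of $G$, i.e. a functor from $G$ (regarded as a one-object category) to the category $\mathcal Cat$ of small categories and functors. For $n\ge 0$ let $\mathcal C^{[n]}$ be the category of functors $[n]=\{0\le\dots\le n\}\to\mathcal C$ and natural transformations, let $\mathrm{iso}(\mathcal C)^{[n]}$ be its maximal subgroupoid, and let $B$ denote the classifying space (the geometric realization of the nerve). Let $N^G(\mathcal C)$ be the simplicial $G$-space with $N^G(\mathcal C)_n=B(\mathrm{iso}(\mathcal C)^{[n]})$, with the simplicial structure given by precomposition with the order-preserving maps $[m]\to[n]$ and with the induced action of $G$. Then $N^G(\mathcal C)$ is a complete Segal $G$-space. Here all spaces are compactly generated Hausdorff spaces, limits and mapping spaces being formed in that category; so the assertion includes that every $N^G(\mathcal C)_n$ is compactly generated and Hausdorff. A map $f\colon A\to B$ of $G$-spaces is a $G$-equivalence (resp. a $G$-fibration) if for every subgroup $H\le G$ the map of fixed-point spaces $f^H\colon A^H\to B^H$ induces bijections on $\pi_0$ and on $\pi_i$ for all $i\ge 1$ and all base points (resp. is a Serre fibration). A simplicial $G$-space $X$ is a complete Segal $G$-space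 if: 1. $X$ is Reedy fibrant: for every $n\ge 0$ the map $X_n\to M_nX$ to the $n$-th matching object is a $G$-fibration; 2. for every $n\ge 2$ the Segal map $X_n\to X_1\times_{X_0}\cdots\times_{X_0}X_1$ ($n$ factors), induced by the maps $[1]\to[n]$, $0\mapsto i$, $1\mapsto i+1$ for $0\le i<n$, is a $G$-equivalence; 3. $X$ is local with respect to the maps $G/H\times E\to G/H\times\Delta[0]$ for all subgroups $H\le G$, where $E$ is the nerve of the category with two objects and exactly one isomorphism between them, and simplicial sets are regarded as discrete simplicial spaces with trivial $G$-action: the map $\mathrm{Map}(G/H\times\Delta[0],X)\to\mathrm{Map}(G/H\times E,X)$ of spaces of maps of simplicial $G$-spaces is a weak equivalence. -/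

import Mathlib

open CategoryTheory Opposite Simplicial Topology

universe u

noncomputable section

namespace EquivariantSegal

/-! ### Weak equivalences and Serre fibrations of topological spaces -/

section Spaces

variable {X Y : Type u} [TopologicalSpace X] [TopologicalSpace Y]

/-- The map induced by a continuous map on sets of path components. -/
def piZeroMap (f : C(X, Y)) : ZerothHomotopy X → ZerothHomotopy Y :=
  Quotient.map f fun _ _ h => h.map f.continuous

/-- The map induced by a continuous map on homotopy groups. -/
def piMap (n : ℕ) (f : C(X, Y)) (x : X) :
    HomotopyGroup.Pi n X x → HomotopyGroup.Pi n Y (f x) :=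
  Quotient.map
    (fun p : GenLoop (Fin n) X x =>
      (⟨f.comp p.1, fun y hy => congrArg f (p.2 y hy)⟩ : GenLoop (Fin n) Y (f x)))
    (fun _ _ h => h.map fun H => H.compContinuousMap f)

/-- `f` induces bijections on path components and on all homotopy groups at all base points. -/
structure IsWeakEquiv (f : C(X, Y)) : Prop where
  bijective_zero : Function.Bijective (piZeroMap f)
  bijective_succ : ∀ (n : ℕ) (x : X), Function.Bijective (piMap (n + 1) f x)

/-- The closed unit disk of dimension `n`. -/
abbrev Disk (n : ℕ) : Type := Metric.closedBall (0 : EuclideanSpace ℝ (Fin n)) 1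

/-- Serre fibrations: the right lifting property with respect to all inclusions
`i₀ : Dⁿ → Dⁿ × I`. -/
def IsSerreFibration (f : C(X, Y)) : Prop :=
  ∀ (n : ℕ) (a : C(Disk n, X)) (h : C(Disk n × unitInterval, Y)),
    (∀ d, h (d, 0) = f (a d)) →
      ∃ k : C(Disk n × unitInterval, X), (∀ d, k (d, 0) = a d) ∧ ∀ z, f (k z) = h z

end Spaces

/-! ### `G`-spaces -/

/-- Spaces with an action of the discrete group `G`, and continuous equivariant maps. -/
abbrev GTop (G : Type u) [Group G] := Action TopCat.{u} G

variable {G : Type u} [Group G]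

instance (A : GTop G) : MulAction G A.V where
  smul g x := (A.ρ g).hom x
  one_smul x := by
    change (A.ρ 1).hom x = x
    rw [map_one]; rfl
  mul_smul g h x := by
    change (A.ρ (g * h)).hom x = (A.ρ g).hom ((A.ρ h).hom x)
    rw [map_mul]; rfl

instance (A : GTop G) : ContinuousConstSMul G A.V where
  continuous_const_smul g := (A.ρ g).hom.continuous

/-- A topological space with a continuous action of `G`, as an object of `GTop G`. -/
def GTop.of (X : Type u) [TopologicalSpace X] [MulAction G X] [ContinuousConstSMul G X] :
    GTop G where
  V := TopCat.of X
  ρ :=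
    { toFun := fun g => TopCat.ofHom ⟨fun x => g • x, continuous_const_smul g⟩
      map_one' := TopCat.hom_ext (ContinuousMap.ext fun x => one_smul G (x : X))
      map_mul' := fun g h => TopCat.hom_ext (ContinuousMap.ext fun x => mul_smul g h (x : X)) }

/-- The underlying continuous map of a map of `G`-spaces. -/
abbrev GTop.map {A B : GTop G} (f : A ⟶ B) : C(A.V, B.V) := f.hom.hom

theorem GTop.map_smul {A B : GTop G} (f : A ⟶ B) (g : G) (x : A.V) :
    GTop.map f (g • x) = g • GTop.map f x :=
  ConcreteCategory.congr_hom (f.comm g) x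

/-- The space `A^H` of `H`-fixed points. -/
abbrev GTop.Fixed (H : Subgroup G) (A : GTop G) : Type u := {x : A.V // ∀ h ∈ H, h • x = x}

/-- The map `f^H : A^H → B^H`. -/
def GTop.fixedMap (H : Subgroup G) {A B : GTop G} (f : A ⟶ B) : C(A.Fixed H, B.Fixed H) where
  toFun x := ⟨GTop.map f x.1, fun h hh => by rw [← GTop.map_smul, x.2 h hh]⟩
  continuous_toFun := by fun_prop

/-- Weak equivalences of `G`-spaces. -/
def IsGEquivalence {A B : GTop G} (f : A ⟶ B) : Prop :=
  ∀ H : Subgroup G, IsWeakEquiv (GTop.fixedMap H f)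

/-- Fibrations of `G`-spaces. -/
def IsGFibration {A B : GTop G} (f : A ⟶ B) : Prop :=
  ∀ H : Subgroup G, IsSerreFibration (GTop.fixedMap H f)

/-- A map of `G`-spaces given by a continuous equivariant map. -/
def GTop.homMk {A B : GTop G} (f : C(A.V, B.V)) (hf : ∀ (g : G) (x : A.V), f (g • x) = g • f x) :
    A ⟶ B where
  hom := TopCat.ofHom f
  comm g := TopCat.hom_ext (ContinuousMap.ext fun x => hf g x)

/-! ### Compactly generated limits

A limit of compactly generated Hausdorff spaces, formed in the category of compactly generated
Hausdorff spaces, is the usual limit of topological spaces with its topology replaced by the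
compactly generated one. Mathlib calls the latter space `CompactCoherentification`. -/

section Coherent

open scoped CompactCoherentification

instance (X : Type u) [MulAction G X] : MulAction G (𝐤 X) :=
  inferInstanceAs (MulAction G X)

instance (X : Type u) [TopologicalSpace X] [MulAction G X] [ContinuousConstSMul G X] :
    ContinuousConstSMul G (𝐤 X) where
  continuous_const_smul g :=
    CompactCoherentification.continuous_map_of_continuous (X := X) (Y := X)
      (f := fun x => g • x) (continuous_const_smul g)

/-- A continuous map from a compactly generated space, with the topology of the target replaced by
the compactly generated one. -/
def toCoherent {X Y : Type u} [TopologicalSpace X] [CompactlyCoherentSpace X]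
    [TopologicalSpace Y] (f : C(X, Y)) : C(X, 𝐤 Y) where
  toFun x := CompactCoherentification.mk Y (f x)
  continuous_toFun :=
    (CompactCoherentification.continuous_map_of_continuous f.continuous).comp
      CompactCoherentification.continuous_mk

/-- A continuous map, with both topologies replaced by the compactly generated ones. -/
def mapCoherent {X Y : Type u} [TopologicalSpace X] [TopologicalSpace Y] (f : C(X, Y)) :
    C(𝐤 X, 𝐤 Y) where
  toFun := CompactCoherentification.map f
  continuous_toFun := CompactCoherentification.continuous_map_of_continuous f.continuous

/-! ### Simplicial `G`-spaces -/

variable (G) in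
/-- Simplicial objects in `G`-spaces. The standing convention that all spaces be compactly
generated and Hausdorff is the property `IsCGHaus`. -/
abbrev SimplicialGSpace := SimplicialObject (GTop G)

/-- All the spaces `X_n` are compactly generated and Hausdorff. -/
class IsCGHaus (X : SimplicialGSpace G) : Prop where
  t2 : ∀ m, T2Space (X.obj m).V
  compactlyGenerated : ∀ m, CompactlyCoherentSpace (X.obj m).V

instance (X : SimplicialGSpace G) [IsCGHaus X] (m : SimplexCategoryᵒᵖ) :
    CompactlyCoherentSpace (X.obj m).V :=
  IsCGHaus.compactlyGenerated m

/-- The set of maps of simplicial sets from `K` to the simplicial set of points of `X`, with the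
topology of a subspace of the product of copies of the `X_m` indexed by the `m`-simplices of `K`:
the limit of `X` weighted by `K`. -/
abbrev WeightedLimit (K : SSet.{u}) (X : SimplicialGSpace G) : Type u :=
  {x : ∀ m : SimplexCategoryᵒᵖ, K.obj m → (X.obj m).V //
    ∀ (m m' : SimplexCategoryᵒᵖ) (f : m ⟶ m') (s : K.obj m),
      x m' (K.map f s) = GTop.map (X.map f) (x m s)}

instance (K : SSet.{u}) (X : SimplicialGSpace G) : MulAction G (WeightedLimit K X) where
  smul g x := ⟨fun m s => g • x.1 m s, fun m m' f s => by
    change g • x.1 m' (K.map f s) = GTop.map (X.map f) (g • x.1 m s)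
    rw [x.2, GTop.map_smul]⟩
  one_smul x := Subtype.ext (funext fun m => funext fun s => one_smul G (x.1 m s))
  mul_smul g h x := Subtype.ext (funext fun m => funext fun s => mul_smul g h (x.1 m s))

instance (K : SSet.{u}) (X : SimplicialGSpace G) : ContinuousConstSMul G (WeightedLimit K X) where
  continuous_const_smul g :=
    Continuous.subtype_mk (continuous_pi fun m => continuous_pi fun s =>
      (continuous_const_smul g).comp
        (show Continuous fun x : WeightedLimit K X => x.1 m s from
          (continuous_apply s).comp ((continuous_apply m).comp continuous_subtype_val))) _

/-- The `n`-th matching object `M_n X`, the limit of `X` weighted by the boundary of `Δ[n]`. -/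
def matchingObject (X : SimplicialGSpace G) (n : ℕ) : GTop G :=
  GTop.of (𝐤 (WeightedLimit (SSet.boundary.{u} n : SSet.{u}) X))

/-- The matching map `X_n → M_n X`. It sends `x` to the family of all `s^* x`, where `s` runs
through the simplices of the boundary of `Δ[n]`. -/
def matchingMap (X : SimplicialGSpace G) [IsCGHaus X] (n : ℕ) :
    X.obj (op ⦋n⦌) ⟶ matchingObject X n :=
  GTop.homMk
    (B := GTop.of (𝐤 (WeightedLimit (SSet.boundary.{u} n : SSet.{u}) X)))
    (toCoherent (Y := WeightedLimit (SSet.boundary.{u} n : SSet.{u}) X)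
      ⟨fun x => ⟨fun _ s => GTop.map (X.map (SSet.stdSimplex.objEquiv s.1).op) x,
        fun _ _ f s => congrArg (fun φ => GTop.map φ x)
          (X.map_comp (SSet.stdSimplex.objEquiv s.1).op f)⟩,
        Continuous.subtype_mk (continuous_pi fun _ => continuous_pi
          fun _ => ContinuousMap.continuous _) _⟩)
    (fun g x => Subtype.ext (funext fun _ => funext fun _ => GTop.map_smul _ g x))

/-- Reedy fibrancy with respect to the fibrations of `G`-spaces. -/
def IsReedyFibrant (X : SimplicialGSpace G) [IsCGHaus X] : Prop :=
  ∀ n : ℕ, IsGFibration (matchingMap X n)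

/-- The iterated fibre product `X_1 ×_{X_0} ⋯ ×_{X_0} X_1` with `n` factors: the target `d_0` of
each entry is the source `d_1` of the next one. -/
abbrev FibreProduct (X : SimplicialGSpace G) (n : ℕ) : Type u :=
  {x : Fin n → (X.obj (op ⦋1⦌)).V //
    ∀ i j : Fin n, (i : ℕ) + 1 = j → GTop.map (X.δ 0) (x i) = GTop.map (X.δ 1) (x j)}

instance (X : SimplicialGSpace G) (n : ℕ) : MulAction G (FibreProduct X n) where
  smul g x := ⟨fun i => g • x.1 i, fun i j h => by
    rw [GTop.map_smul, GTop.map_smul, x.2 i j h]⟩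
  one_smul x := Subtype.ext (funext fun i => one_smul G (x.1 i))
  mul_smul g h x := Subtype.ext (funext fun i => mul_smul g h (x.1 i))

instance (X : SimplicialGSpace G) (n : ℕ) : ContinuousConstSMul G (FibreProduct X n) where
  continuous_const_smul g :=
    Continuous.subtype_mk (continuous_pi fun i =>
      (((continuous_apply i).comp continuous_subtype_val).const_smul g :
        Continuous fun x : FibreProduct X n => g • x.1 i)) _

/-- The iterated fibre product as a `G`-space. -/
def segalObject (X : SimplicialGSpace G) (n : ℕ) : GTop G :=
  GTop.of (𝐤 (FibreProduct X n))

theorem succ_edge (n : ℕ) (i j : Fin n) (h : (i : ℕ) + 1 = j) :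
    SimplexCategory.δ 0 ≫ SimplexCategory.mkOfSucc i =
      SimplexCategory.δ 1 ≫ SimplexCategory.mkOfSucc j := by
  ext k
  fin_cases k
  exact h

/-- The Segal map `X_n → X_1 ×_{X_0} ⋯ ×_{X_0} X_1`, induced by the maps `[1] → [n]` which send
`0, 1` to `i, i + 1`, for `0 ≤ i < n`. -/
def segalMap (X : SimplicialGSpace G) [IsCGHaus X] (n : ℕ) :
    X.obj (op ⦋n⦌) ⟶ segalObject X n :=
  GTop.homMk (B := GTop.of (𝐤 (FibreProduct X n)))
    (toCoherent (Y := FibreProduct X n)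
      ⟨fun x => ⟨fun i => GTop.map (X.map (SimplexCategory.mkOfSucc i).op) x,
        fun i j h => by
          have e : X.map (SimplexCategory.mkOfSucc i).op ≫ X.δ 0 =
              X.map (SimplexCategory.mkOfSucc j).op ≫ X.δ 1 := by
            simp only [SimplicialObject.δ, ← X.map_comp, ← op_comp, succ_edge n i j h]
          exact ConcreteCategory.congr_hom (congrArg Action.Hom.hom e) x⟩,
        Continuous.subtype_mk (continuous_pi fun i =>
          (GTop.map (X.map (SimplexCategory.mkOfSucc i).op)).continuous) _⟩)
    (fun g x => Subtype.ext (funext fun i => GTop.map_smul _ g x))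

/-- Segal `G`-spaces: Reedy fibrant simplicial `G`-spaces whose Segal maps are `G`-equivalences. -/
structure IsSegalGSpace (X : SimplicialGSpace G) [IsCGHaus X] : Prop where
  reedyFibrant : IsReedyFibrant X
  segal : ∀ n : ℕ, 2 ≤ n → IsGEquivalence (segalMap X n)

/-! ### Mapping spaces and completeness -/

/-- Maps of simplicial `G`-spaces, topologized as a subspace of the product over `m` of the spaces
of continuous maps from `A_m` to `X_m`. -/
def MapSpace (A X : SimplicialGSpace G) : Type u := A ⟶ X

instance (A X : SimplicialGSpace G) : TopologicalSpace (MapSpace A X) :=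
  TopologicalSpace.induced
    (fun (φ : A ⟶ X) (m : SimplexCategoryᵒᵖ) => GTop.map (φ.app m)) inferInstance

theorem continuous_mapSpace_apply {A X : SimplicialGSpace G} (m : SimplexCategoryᵒᵖ) :
    Continuous fun φ : MapSpace A X => GTop.map (NatTrans.app (φ : A ⟶ X) m) :=
  continuous_pi_iff.1 (continuous_iff_le_induced.2 le_rfl :
    Continuous fun (φ : MapSpace A X) (m : SimplexCategoryᵒᵖ) =>
      GTop.map (NatTrans.app (φ : A ⟶ X) m)) m

/-- Precomposition with `p : A → B`, as a map of (compactly generated) mapping spaces. -/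
def precompMap {A B : SimplicialGSpace G} (p : A ⟶ B) (X : SimplicialGSpace G) :
    C(𝐤 (MapSpace B X), 𝐤 (MapSpace A X)) :=
  mapCoherent (X := MapSpace B X) (Y := MapSpace A X)
    ⟨fun φ => p ≫ (φ : B ⟶ X), continuous_induced_rng.2 (continuous_pi fun m =>
      (ContinuousMap.continuous_precomp (GTop.map (p.app m))).comp
        (continuous_mapSpace_apply m))⟩

end Coherent

/-- The product `G/H × S` of discrete spaces, with `G` acting on the first factor. -/
def OrbitProd (H : Subgroup G) (S : Type u) : Type u := (G ⧸ H) × S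

instance (H : Subgroup G) (S : Type u) : TopologicalSpace (OrbitProd H S) := ⊥

instance (H : Subgroup G) (S : Type u) : DiscreteTopology (OrbitProd H S) := ⟨rfl⟩

instance (H : Subgroup G) (S : Type u) : MulAction G (OrbitProd H S) where
  smul g x := (g • x.1, x.2)
  one_smul x := Prod.ext (one_smul G x.1) rfl
  mul_smul g h x := Prod.ext (mul_smul g h x.1) rfl

instance (H : Subgroup G) (S : Type u) : ContinuousConstSMul G (OrbitProd H S) where
  continuous_const_smul _ := continuous_of_discreteTopology

/-- The map `G/H × S → G/H × T` induced by a map of sets `S → T`. -/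
def orbitMap (H : Subgroup G) {S T : Type u} (f : S → T) :
    GTop.of (G := G) (OrbitProd H S) ⟶ GTop.of (OrbitProd H T) :=
  GTop.homMk (A := GTop.of (OrbitProd H S)) (B := GTop.of (OrbitProd H T))
    (⟨fun x => (x.1, f x.2), continuous_of_discreteTopology⟩ :
      C(OrbitProd H S, OrbitProd H T))
    (fun _ _ => rfl)

/-- The simplicial `G`-space `G/H × K`, where the simplicial set `K` is regarded as a discrete
simplicial space with trivial action. -/
def orbitTensor (H : Subgroup G) (K : SSet.{u}) : SimplicialGSpace G where
  obj m := GTop.of (OrbitProd H (K.obj m))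
  map f := orbitMap H (K.map f)
  map_id m := by
    rw [K.map_id]; rfl
  map_comp f g := by
    rw [K.map_comp]; rfl

/-- The map `G/H × K → G/H × L` induced by a map of simplicial sets `K → L`. -/
def orbitTensorMap (H : Subgroup G) {K L : SSet.{u}} (p : K ⟶ L) :
    orbitTensor H K ⟶ orbitTensor H L where
  app m := orbitMap H (p.app m)
  naturality m m' f := by
    change orbitMap H (K.map f) ≫ orbitMap H (p.app m') =
      orbitMap H (p.app m) ≫ orbitMap H (L.map f)
    have h := p.naturality f
    apply Action.hom_ext
    refine TopCat.hom_ext (ContinuousMap.ext fun x => Prod.ext rfl ?_)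
    exact ConcreteCategory.congr_hom h x.2

/-- Complete Segal `G`-spaces: Segal `G`-spaces which are local with respect to the maps
`G/H × E → G/H × Δ[0]`, where `E` is the nerve of the category with two objects and a unique
isomorphism between them. Since `G/H × K` is Reedy cofibrant for every simplicial set `K`, and `X`
is Reedy fibrant, the mapping spaces which occur are the homotopy invariant ones. -/
structure IsCompleteSegalGSpace (X : SimplicialGSpace G) [IsCGHaus X] : Prop
    extends IsSegalGSpace X where
  complete : ∀ H : Subgroup G,
    IsWeakEquiv (precompMap
      (orbitTensorMap H (SSet.stdSimplex.isTerminalObj₀.from SSet.coherentIso.{u})) X)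

/-! ### The classifying diagram -/

/-- The maximal subgroupoid of the category `C^[n]` of functors `[n] → C`, as a functor of `C`. -/
def isoPow (m : SimplexCategoryᵒᵖ) : Cat.{u, u} ⥤ Cat.{u, u} where
  obj C := Cat.of (Core (ComposableArrows C m.unop.len))
  map F := (F.toFunctor.mapComposableArrows m.unop.len).core.toCatHom

/-- The restriction from `C^[n]` to `C^[m]` along a map `[m] → [n]`, on maximal subgroupoids. -/
def isoPowMap {m m' : SimplexCategoryᵒᵖ} (f : m ⟶ m') : isoPow.{u} m ⟶ isoPow.{u} m' where
  app C := (((Functor.whiskeringLeft _ _ C).obj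
    (SimplexCategory.toCat.map f.unop).toFunctor).core).toCatHom

/-- The classifying space, i.e. the geometric realization of the nerve. -/
def classifyingSpace : Cat.{u, u} ⥤ TopCat.{u} := nerveFunctor ⋙ SSet.toTop

/-- The `G`-classifying diagram of a small category `C` with an action of `G` by functors: the
simplicial `G`-space with `n`-th space the classifying space of the maximal subgroupoid
of `C^[n]`. -/
def classifyingDiagram (C : Action Cat.{u, u} G) : SimplicialGSpace G where
  obj m := ((isoPow m ⋙ classifyingSpace).mapAction G).obj C
  map f :=
    { hom := (Functor.whiskerRight (isoPowMap f) classifyingSpace).app C.V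
      comm := fun g => (Functor.whiskerRight (isoPowMap f) classifyingSpace).naturality (C.ρ g) }
  map_id m := by
    apply Action.hom_ext
    change classifyingSpace.map ((isoPowMap (𝟙 m)).app C.V) = 𝟙 _
    exact classifyingSpace.map_id ((isoPow m).obj C.V)
  map_comp f g := by
    apply Action.hom_ext
    change classifyingSpace.map ((isoPowMap (f ≫ g)).app C.V) =
      classifyingSpace.map ((isoPowMap f).app C.V) ≫ classifyingSpace.map ((isoPowMap g).app C.V)
    rw [← classifyingSpace.map_comp]
    rfl

end EquivariantSegal

end

/-! The whole argument rests on a combinatorial model of points of a geometric realization. A point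
`t` of a simplex is read as a monotone step function from [0, 1) to [n] whose j-th step has length
`t j`. Finitely many step functions have a common subdivision (`exists_refinement`), so finitely
many points, even of different realizations, are represented over one and the same interior `u`.
Over a fixed interior `u` the representing simplex is unique (`pt_injective`). Hence statements
about points which involve finitely many simplicial sets (equalities, matching conditions, products)
reduce to statements about simplices.

The topology is controlled by sampling: evaluating step functions at chosen times gives simplices
that depend only on the point, and the measure of the set of times giving a fixed simplex is
continuous in the point. Majority votes over times separate points (Hausdorffness) and separate the
sheets over the realization of a simplicial covering (`IsSimplicialCovering.isCoveringMap`). Compact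
sets meet finitely many cells, so that continuity on compact spaces can be tested after a finite
jointly injective family of simplicial maps (`JointlyInjective.continuous`).

For the classifying diagram, a p-simplex of the nerve of iso(C^[n]) is an n-simplex of the nerve of
a category of p-chains of isomorphisms (`transpose`). Strict Segality of nerves makes every Segal
map bijective, with inverse continuous on compact spaces. A morphism between chains of isomorphisms
is determined by any one component, which may be arbitrary; so X_1 → X_0 × X_0 is a covering.
Homotopies in X_n therefore lift uniquely along homotopies of the vertices. Existence gives lifts
against the matching map; uniqueness makes these lifts compatible with the boundary and fixed by H.
These properties form `IsStrictSegal`, and they imply Reedy fibrancy and the Segal condition on all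
fixed points.

For completeness, a map from G/H × E is an H-fixed point of the realization of the nerve of the
groupoid of isomorphisms in C (`exists_eval_eq`). Contracting the free-living isomorphism to its
first object gives a deformation of that realization onto the constant diagrams. It is natural in C,
hence commutes with G, and it exhibits the mapping space out of G/H × Δ[0] as a deformation retract.
-/

noncomputable section

namespace EquivariantSegal

/-! ### Points of the geometric realization -/

section Points

open SimplexCategory

/-- The standard topological simplex. -/
abbrev TopSimplex (n : SimplexCategory) : Type := stdSimplex ℝ (Fin (n.len + 1))

/-- The map of topological simplices induced by a map in the simplex category. -/
abbrev TopSimplex.map {m n : SimplexCategory} (f : m ⟶ n) (t : TopSimplex m) : TopSimplex n :=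
  stdSimplex.map f t

variable {K L : SSet.{u}}

/-- The point of the geometric realization with coordinates `t` in the simplex `σ`. -/
def pt {n : SimplexCategory} (σ : K.obj (op n)) (t : TopSimplex n) : SSet.toTop.obj K :=
  SSet.toTop.map (SSet.yonedaEquiv.symm σ) (n.toTopHomeo.symm t)

theorem continuous_pt {n : SimplexCategory} (σ : K.obj (op n)) : Continuous (pt σ) :=
  (SSet.toTop.map (SSet.yonedaEquiv.symm σ)).hom.continuous.comp n.toTopHomeo.symm.continuous

theorem pt_map {m n : SimplexCategory} (f : m ⟶ n) (σ : K.obj (op n)) (t : TopSimplex m) :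
    pt (K.map f.op σ) t = pt σ (TopSimplex.map f t) := by
  have h : SSet.yonedaEquiv.symm (K.map f.op σ) =
      SSet.stdSimplex.map f ≫ SSet.yonedaEquiv.symm σ := by
    ext d a
    exact (ConcreteCategory.congr_hom (K.map_comp f.op (SSet.stdSimplex.objEquiv a).op) σ).symm
  rw [pt, pt, h, Functor.map_comp, TopSimplex.map, toTopHomeo_symm_naturality_apply]
  rfl

theorem toTop_map_pt (φ : K ⟶ L) {n : SimplexCategory} (σ : K.obj (op n)) (t : TopSimplex n) :
    SSet.toTop.map φ (pt σ t) = pt (φ.app _ σ) t := by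
  have h : SSet.yonedaEquiv.symm (φ.app _ σ) = SSet.yonedaEquiv.symm σ ≫ φ :=
    (SSet.yonedaEquiv_symm_comp σ φ).symm
  rw [pt, pt, h, Functor.map_comp]
  rfl

/-- Translates the adjunction between realization and singular simplices into the coordinates `pt`;
the universal property is used only in this form. -/
theorem toSSetObjEquiv_homEquiv_app {Z : TopCat.{u}} (g : SSet.toTop.obj K ⟶ Z)
    {n : SimplexCategory} (σ : K.obj (op n)) (t : TopSimplex n) :
    Z.toSSetObjEquiv (op n) ((sSetTopAdj.homEquiv K Z g).app _ σ) t = g (pt σ t) := by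
  rw [Adjunction.homEquiv_unit]
  have h := sSetTopAdj_unit_app_app_down K (op n) σ
  change (((sSetTopAdj.unit.app K).app (op n) σ).down ≫ g) (ULift.up t) = _
  rw [h]
  rfl

/-- A compatible family of continuous functions on simplices descends to the realization. -/
theorem exists_desc {Z : Type u} [TopologicalSpace Z]
    (F : ∀ n : SimplexCategory, K.obj (op n) → TopSimplex n → Z)
    (hF : ∀ n σ, Continuous (F n σ))
    (hmap : ∀ {m n : SimplexCategory} (f : m ⟶ n) (σ : K.obj (op n)) (t : TopSimplex m),
      F m (K.map f.op σ) t = F n σ (TopSimplex.map f t)) :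
    ∃ g : C(SSet.toTop.obj K, Z), ∀ (n : SimplexCategory) (σ : K.obj (op n)) (t : TopSimplex n),
      g (pt σ t) = F n σ t := by
  let φ : K ⟶ TopCat.toSSet.obj (TopCat.of Z) :=
    { app := fun n => TypeCat.ofHom fun σ => ((TopCat.of Z).toSSetObjEquiv n).symm
          ⟨F n.unop σ, hF _ _⟩
      naturality := fun n m f => by
        ext σ
        refine ((TopCat.of Z).toSSetObjEquiv m).injective ?_
        ext t
        exact hmap f.unop σ t }
  refine ⟨((sSetTopAdj.homEquiv K (TopCat.of Z)).symm φ).hom, fun n σ t => ?_⟩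
  have h := toSSetObjEquiv_homEquiv_app (Z := TopCat.of Z)
    ((sSetTopAdj.homEquiv K (TopCat.of Z)).symm φ) σ t
  rw [Equiv.apply_symm_apply] at h
  exact h.symm

/-- With the indiscrete topology on the target every function is continuous, so the universal
property of the realization also governs bare functions. -/
theorem hom_ext_pt {Z : Type u} {g h : SSet.toTop.obj K → Z}
    (H : ∀ (n : SimplexCategory) (σ : K.obj (op n)) (t : TopSimplex n),
      g (pt σ t) = h (pt σ t)) : g = h := by
  let : TopologicalSpace Z := ⊤
  let g' : SSet.toTop.obj K ⟶ TopCat.of Z := TopCat.ofHom ⟨g, continuous_top⟩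
  let h' : SSet.toTop.obj K ⟶ TopCat.of Z := TopCat.ofHom ⟨h, continuous_top⟩
  have e : g' = h' := by
    refine (sSetTopAdj.homEquiv K (TopCat.of Z)).injective ?_
    ext n σ
    refine ((TopCat.of Z).toSSetObjEquiv n).injective ?_
    ext t
    exact (toSSetObjEquiv_homEquiv_app g' σ t).trans
      ((H _ σ t).trans (toSSetObjEquiv_homEquiv_app h' σ t).symm)
  exact congrArg (fun k : SSet.toTop.obj K ⟶ TopCat.of Z => (k.hom : SSet.toTop.obj K → Z)) e

/-- The predicate "is of the form `pt σ t`" and the constant predicate `True` agree on all `pt σ t`,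
hence everywhere. -/
theorem exists_pt (x : SSet.toTop.obj K) :
    ∃ (n : SimplexCategory) (σ : K.obj (op n)) (t : TopSimplex n), pt σ t = x := by
  have h := hom_ext_pt (K := K) (Z := ULift Prop)
    (g := fun x => ⟨∃ (n : SimplexCategory) (σ : K.obj (op n)) (t : TopSimplex n), pt σ t = x⟩)
    (h := fun _ => ⟨True⟩) (fun n σ t => congrArg _ (eq_true ⟨n, σ, t, rfl⟩))
  exact of_eq_true (congrArg ULift.down (congrFun h x))

/-- Not necessarily continuous functions on the realization. -/
theorem exists_desc_fun {Z : Type u}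
    (F : ∀ n : SimplexCategory, K.obj (op n) → TopSimplex n → Z)
    (hmap : ∀ {m n : SimplexCategory} (f : m ⟶ n) (σ : K.obj (op n)) (t : TopSimplex m),
      F m (K.map f.op σ) t = F n σ (TopSimplex.map f t)) :
    ∃ g : SSet.toTop.obj K → Z, ∀ (n : SimplexCategory) (σ : K.obj (op n)) (t : TopSimplex n),
      g (pt σ t) = F n σ t := by
  let : TopologicalSpace Z := ⊤
  obtain ⟨g, hg⟩ := exists_desc F (fun _ _ => continuous_top) hmap
  exact ⟨g, hg⟩

/-- Open sets are continuous maps to the Sierpiński space, and these can be glued from the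
simplices. -/
theorem isOpen_iff_pt {U : Set (SSet.toTop.obj K)} :
    IsOpen U ↔ ∀ (n : SimplexCategory) (σ : K.obj (op n)), IsOpen (pt σ ⁻¹' U) := by
  refine ⟨fun h n σ => h.preimage (continuous_pt σ), fun h => ?_⟩
  obtain ⟨g, hg⟩ := exists_desc (K := K) (Z := ULift Prop) (fun _ σ t => ⟨pt σ t ∈ U⟩)
    (fun n σ => continuous_uliftUp.comp (isOpen_iff_continuous_mem.1 (h n σ)))
    (fun f σ t => by rw [pt_map])
  have : U = {x | (g x).down} := by
    ext x
    obtain ⟨n, σ, t, rfl⟩ := exists_pt x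
    rw [Set.mem_ofPred_eq, hg]
  rw [this]
  exact isOpen_iff_continuous_mem.2 (continuous_uliftDown.comp g.continuous)

theorem isClosed_iff_pt {U : Set (SSet.toTop.obj K)} :
    IsClosed U ↔ ∀ (n : SimplexCategory) (σ : K.obj (op n)), IsClosed (pt σ ⁻¹' U) := by
  simp only [← isOpen_compl_iff, isOpen_iff_pt, Set.preimage_compl]

theorem continuous_iff_pt {Z : Type*} [TopologicalSpace Z] {g : SSet.toTop.obj K → Z} :
    Continuous g ↔ ∀ (n : SimplexCategory) (σ : K.obj (op n)), Continuous fun t => g (pt σ t) := by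
  refine ⟨fun h n σ => h.comp (continuous_pt σ), fun h => ⟨fun V hV => ?_⟩⟩
  exact isOpen_iff_pt.2 fun n σ => hV.preimage (h n σ)

instance : CompactlyCoherentSpace (SSet.toTop.obj K) :=
  .of_isOpen_forall_compactSpace fun s hs => isOpen_iff_pt.2 fun n σ => by
    have : CompactSpace (TopSimplex n) := isCompact_iff_compactSpace.1 (isCompact_stdSimplex ℝ _)
    have h := hs (ULift.{u} (TopSimplex n)) (fun t => pt σ t.down)
      ((continuous_pt σ).comp continuous_uliftDown)
    exact h.preimage (continuous_uliftUp (X := TopSimplex n))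

end Points

/-! ### Points of a simplex as step functions -/

section Steps

open MeasureTheory

variable {m n : SimplexCategory}

theorem TopSimplex.map_apply (f : m ⟶ n) (t : TopSimplex m) (j : Fin (n.len + 1)) :
    TopSimplex.map f t j = ∑ i with f i = j, t i := by
  rw [TopSimplex.map, stdSimplex.map_coe, FunOnFinite.linearMap_apply_apply]

/-- The number `x` lies in the `j`-th interval of the subdivision of `[0, 1)` into intervals of
lengths `t 0, t 1, …`. -/
def IsStep (t : TopSimplex n) (x : ℝ) (j : Fin (n.len + 1)) : Prop :=
  ∑ i with i < j, t i ≤ x ∧ x < ∑ i with i ≤ j, t i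

theorem TopSimplex.sum_mono (t : TopSimplex n) {p q : Fin (n.len + 1) → Prop} [DecidablePred p]
    [DecidablePred q] (h : ∀ i, p i → q i) : ∑ i with p i, t i ≤ ∑ i with q i, t i :=
  Finset.sum_le_sum_of_subset_of_nonneg (Finset.monotone_filter_right _ fun i _ => h i)
    fun i _ _ => stdSimplex.zero_le t i

theorem IsStep.le {t : TopSimplex n} {x y : ℝ} {i j : Fin (n.len + 1)} (hx : IsStep t x i)
    (hy : IsStep t y j) (h : x ≤ y) : i ≤ j := by
  by_contra! hij
  have := t.sum_mono (p := (· ≤ j)) (q := (· < i)) fun k hk => hk.trans_lt hij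
  linarith [hx.1, hy.2]

theorem IsStep.unique {t : TopSimplex n} {x : ℝ} {i j : Fin (n.len + 1)} (hx : IsStep t x i)
    (hy : IsStep t x j) : i = j :=
  le_antisymm (hx.le hy le_rfl) (hy.le hx le_rfl)

theorem exists_isStep (t : TopSimplex n) (x : Set.Ico (0 : ℝ) 1) : ∃ j, IsStep t x j := by
  have hl : ∃ j : Fin (n.len + 1), (x : ℝ) < ∑ i with i ≤ j, t i :=
    ⟨Fin.last _, by simpa [Fin.le_last] using x.2.2⟩
  obtain ⟨j, hj, hmin⟩ := WellFounded.has_min (wellFounded_lt (α := Fin (n.len + 1)))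
    {j | (x : ℝ) < ∑ i with i ≤ j, t i} hl
  refine ⟨j, ?_, hj⟩
  rcases Fin.eq_zero_or_eq_succ j with rfl | ⟨k, rfl⟩
  · simpa using x.2.1
  · have := hmin k.castSucc
    simp only [Set.mem_ofPred_eq, Fin.castSucc_lt_succ, not_true_eq_false, imp_false, not_lt] at this
    simpa [Fin.le_castSucc_iff] using this

/-- The step function `[0, 1) → [n]` whose `j`-th step has length `t j`. -/
def step (t : TopSimplex n) : Set.Ico (0 : ℝ) 1 →o Fin (n.len + 1) where
  toFun x := (exists_isStep t x).choose
  monotone' x y h := (exists_isStep t x).choose_spec.le (exists_isStep t y).choose_spec h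

theorem isStep_step (t : TopSimplex n) (x : Set.Ico (0 : ℝ) 1) : IsStep t x (step t x) :=
  (exists_isStep t x).choose_spec

theorem step_eq_iff {t : TopSimplex n} {x : Set.Ico (0 : ℝ) 1} {j : Fin (n.len + 1)} :
    step t x = j ↔ IsStep t x j :=
  ⟨fun h => h ▸ isStep_step t x, fun h => (isStep_step t x).unique h⟩

theorem TopSimplex.sum_map (f : m ⟶ n) (t : TopSimplex m) (p : Fin (n.len + 1) → Prop)
    [DecidablePred p] : ∑ j with p j, TopSimplex.map f t j = ∑ i with p (f i), t i := by
  simp_rw [TopSimplex.map_apply]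
  rw [← Finset.sum_fiberwise_of_maps_to (s := Finset.univ.filter fun i => p (f i))
    (t := Finset.univ.filter p) (g := fun i => f i) (by simp)]
  refine Finset.sum_congr rfl fun j hj => Finset.sum_congr ?_ fun _ _ => rfl
  ext i
  simp only [Finset.mem_filter, Finset.mem_univ, true_and] at hj ⊢
  exact ⟨fun h => ⟨h ▸ hj, h⟩, fun h => h.2⟩

theorem IsStep.map (f : m ⟶ n) {t : TopSimplex m} {x : ℝ} {i : Fin (m.len + 1)}
    (h : IsStep t x i) : IsStep (TopSimplex.map f t) x (f i) := by
  have hf : Monotone f := f.toOrderHom.monotone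
  refine ⟨?_, ?_⟩
  · rw [TopSimplex.sum_map]
    exact (t.sum_mono fun k hk => lt_of_not_ge fun h' => hk.not_ge (hf h')).trans h.1
  · rw [TopSimplex.sum_map]
    exact h.2.trans_le (t.sum_mono fun k hk => hf hk)

/-- Pushing forward along a monotone map merges neighbouring steps without moving them. This is what
makes sampling independent of the representation of a point. -/
theorem step_map (f : m ⟶ n) (t : TopSimplex m) (x : Set.Ico (0 : ℝ) 1) :
    step (TopSimplex.map f t) x = f (step t x) :=
  step_eq_iff.2 ((isStep_step t x).map f)

theorem TopSimplex.sum_le (t : TopSimplex n) (j : Fin (n.len + 1)) :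
    ∑ i with i ≤ j, t i = ∑ i with i < j, t i + t j := by
  rw [add_comm _ (t j), ← Finset.sum_insert (by simp)]
  congr 1
  ext i
  simp [le_iff_eq_or_lt]

theorem IsStep.mem_Ico {t : TopSimplex n} {x : ℝ} {j : Fin (n.len + 1)} (h : IsStep t x j) :
    x ∈ Set.Ico (0 : ℝ) 1 := by
  refine ⟨(Finset.sum_nonneg fun i _ => stdSimplex.zero_le t i).trans h.1, h.2.trans_le ?_⟩
  simpa using t.sum_mono (p := (· ≤ j)) (q := fun _ => True) fun _ _ => trivial

theorem setOf_isStep_eq_Ico (t : TopSimplex n) (j : Fin (n.len + 1)) :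
    {x | IsStep t x j} = Set.Ico (∑ i with i < j, t i) (∑ i with i ≤ j, t i) := rfl

theorem measurableSet_isStep (t : TopSimplex n) (j : Fin (n.len + 1)) :
    MeasurableSet {x | IsStep t x j} := measurableSet_Ico

theorem volume_isStep (t : TopSimplex n) (j : Fin (n.len + 1)) :
    volume.real {x | IsStep t x j} = t j := by
  rw [setOf_isStep_eq_Ico, Real.volume_real_Ico_of_le (t.sum_mono fun _ h => h.le), t.sum_le]
  ring

/-- The open simplex. -/
def TopSimplex.IsInterior (t : TopSimplex n) : Prop := ∀ i, 0 < t i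

theorem TopSimplex.IsInterior.exists_step_eq {t : TopSimplex n} (h : t.IsInterior)
    (j : Fin (n.len + 1)) : ∃ x, step t x = j := by
  have hj : IsStep t (∑ i with i < j, t i) j := ⟨le_rfl, by rw [t.sum_le]; linarith [h j]⟩
  exact ⟨⟨_, hj.mem_Ico⟩, step_eq_iff.2 hj⟩

theorem TopSimplex.IsInterior.surjective {f : m ⟶ n} {t : TopSimplex m}
    (h : (TopSimplex.map f t).IsInterior) : Function.Surjective f := fun j => by
  obtain ⟨x, hx⟩ := h.exists_step_eq j
  exact ⟨step t x, by rw [← step_map, hx]⟩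

/-- Steps are half-open on the right, so finitely many steps that contain `x` also contain a common
right neighbourhood of `x`. Finiteness is needed because `volume.real` sends infinite measure to 0.
-/
theorem isStep_volume_pos {ι : Type*} [Finite ι] {n : ι → SimplexCategory}
    (t : ∀ k, TopSimplex (n k)) {x : ℝ} {j : ∀ k, Fin ((n k).len + 1)}
    (h : ∀ k, IsStep (t k) x (j k)) (hb : volume {y | ∀ k, IsStep (t k) y (j k)} ≠ ⊤) :
    0 < volume.real {y | ∀ k, IsStep (t k) y (j k)} := by
  have hx : {y | ∀ k, IsStep (t k) y (j k)} ∈ 𝓝[>] x := by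
    refine Filter.eventually_all.2 fun k => ?_
    filter_upwards [Ioo_mem_nhdsGT (h k).2] with y hy
    exact ⟨(h k).1.trans hy.1.le, hy.2⟩
  obtain ⟨b, hb', hs⟩ := mem_nhdsGT_iff_exists_Ioo_subset.1 hx
  refine ENNReal.toReal_pos (ne_of_gt (lt_of_lt_of_le ?_ (measure_mono hs))) hb
  simpa using hb'

/-- Finitely many points of simplices have a common refinement. -/
theorem exists_refinement {ι : Type*} [Fintype ι] [Nonempty ι] (n : ι → SimplexCategory)
    (t : ∀ k, TopSimplex (n k)) :
    ∃ (p : SimplexCategory) (u : TopSimplex p) (α : ∀ k, p ⟶ n k), u.IsInterior ∧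
      (∀ k, TopSimplex.map (α k) u = t k) ∧ p.len + 1 ≤ ∏ k, ((n k).len + 1) := by
  classical
  -- The joint step function takes finitely many values. One time is picked for each value; the
  -- chosen times, in increasing order, are the vertices of the refinement, and the weight of a
  -- vertex is the measure of the set of times with its value.
  let f (x : Set.Ico (0 : ℝ) 1) (k : ι) : Fin ((n k).len + 1) := step (t k) x
  let g (r : Set.range f) : Set.Ico (0 : ℝ) 1 := r.2.choose
  have hg (r) : f (g r) = r := r.2.choose_spec
  let S : Finset (Set.Ico (0 : ℝ) 1) := Finset.univ.image g
  have hS : ∀ x, ∃ y ∈ S, f y = f x := fun x =>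
    ⟨g ⟨f x, x, rfl⟩, Finset.mem_image_of_mem _ (Finset.mem_univ _), hg _⟩
  have hinj : ∀ y ∈ S, ∀ z ∈ S, f y = f z → y = z := by
    intro y hy z hz h
    simp only [S, Finset.mem_image, Finset.mem_univ, true_and] at hy hz
    obtain ⟨r, rfl⟩ := hy
    obtain ⟨s, rfl⟩ := hz
    rw [hg, hg] at h
    rw [Subtype.ext h]
  have hne : 0 < S.card := Finset.card_pos.2 ⟨_, (hS ⟨0, by simp⟩).choose_spec.1⟩
  let p : SimplexCategory := ⦋S.card - 1⦌
  have hp : S.card = p.len + 1 := by simp [p]; omega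
  let e := S.orderEmbOfFin hp
  have he : ∀ x, ∃ i, f (e i) = f x := fun x => by
    obtain ⟨y, hy, hyx⟩ := hS x
    have : y ∈ Set.range e := by rw [Finset.range_orderEmbOfFin]; exact hy
    obtain ⟨i, rfl⟩ := this
    exact ⟨i, hyx⟩
  have heinj : ∀ i j, f (e i) = f (e j) → i = j := fun i j h =>
    e.injective (hinj _ (S.orderEmbOfFin_mem hp i) _ (S.orderEmbOfFin_mem hp j) h)
  let A (i : Fin (p.len + 1)) : Set ℝ := {y | ∀ k, IsStep (t k) y (f (e i) k)}
  have hA (i) : MeasurableSet (A i) := by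
    simp only [A, Set.ofPred_forall]
    exact MeasurableSet.iInter fun k => measurableSet_isStep _ _
  have hAfin (i) : volume (A i) ≠ ⊤ := by
    refine ne_top_of_le_ne_top ?_ (measure_mono (t := Set.Ico (0 : ℝ) 1) fun y hy => ?_)
    · simp
    · exact (hy (Classical.arbitrary ι)).mem_Ico
  have hdisj : Pairwise (Function.onFun Disjoint A) := fun i j hij =>
    Set.disjoint_left.2 fun y hy hy' => hij (heinj i j (funext fun k => (hy k).unique (hy' k)))
  have hunion (k : ι) (j) : ⋃ i ∈ Finset.univ.filter fun i => f (e i) k = j, A i =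
      {y | IsStep (t k) y j} := by
    ext y
    simp only [Set.mem_iUnion, Finset.mem_filter, Finset.mem_univ, true_and, exists_prop]
    constructor
    · rintro ⟨i, rfl, hi⟩
      exact hi k
    · intro hy
      obtain ⟨i, hi⟩ := he ⟨y, IsStep.mem_Ico hy⟩
      refine ⟨i, ?_, fun k' => ?_⟩
      · rw [hi]; exact step_eq_iff.2 hy
      · rw [hi]; exact isStep_step (t k') ⟨y, _⟩
  have hsum (k : ι) (j) : ∑ i with f (e i) k = j, volume.real (A i) = t k j := by
    rw [← volume_isStep, ← hunion, measureReal_biUnion_finset (fun i _ j _ hij => hdisj hij)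
      (fun i _ => hA i) (fun i _ => hAfin i)]
  let k₀ := Classical.arbitrary ι
  refine ⟨p, ⟨fun i => volume.real (A i), fun i => measureReal_nonneg, ?_⟩,
    fun k => SimplexCategory.Hom.mk ((step (t k)).comp e.toOrderHom), ?_, ?_, ?_⟩
  · rw [← stdSimplex.sum_eq_one (t k₀), ← Finset.sum_fiberwise Finset.univ (fun i => f (e i) k₀)]
    exact Finset.sum_congr rfl fun j _ => hsum k₀ j
  · exact fun i => isStep_volume_pos t (fun k => isStep_step (t k) (e i)) (hAfin i)
  · intro k
    ext j
    rw [TopSimplex.map_apply]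
    exact hsum k j
  · rw [← hp]
    calc S.card ≤ Fintype.card (Set.range f) := Finset.card_image_le
      _ ≤ Fintype.card (∀ k, Fin ((n k).len + 1)) :=
        Fintype.card_le_of_injective _ Subtype.val_injective
      _ = _ := by simp

end Steps

/-! ### Sampling points of the realization -/

section Sampling

open MeasureTheory

variable {K L : SSet.{u}} {m n : SimplexCategory}

/-- The map `[m] → [n]` obtained by evaluating the step function of `t` at the points `x`. -/
def stepHom (t : TopSimplex n) (x : Fin (m.len + 1) →o Set.Ico (0 : ℝ) 1) : m ⟶ n :=
  SimplexCategory.Hom.mk ((step t).comp x)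

theorem stepHom_apply (t : TopSimplex n) (x : Fin (m.len + 1) →o Set.Ico (0 : ℝ) 1)
    (i : Fin (m.len + 1)) : stepHom t x i = step t (x i) := rfl

theorem simplexHom_ext {f g : m ⟶ n} (h : ∀ i, f i = g i) : f = g :=
  SimplexCategory.Hom.ext _ _ (OrderHom.ext _ _ (funext h))

theorem map_op_congr {f g : m ⟶ n} (h : ∀ i, f i = g i) (σ : K.obj (op n)) :
    K.map f.op σ = K.map g.op σ := by
  rw [simplexHom_ext h]

theorem exists_sample (x : Fin (m.len + 1) →o Set.Ico (0 : ℝ) 1) :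
    ∃ s : SSet.toTop.obj K → K.obj (op m),
      ∀ (n : SimplexCategory) (σ : K.obj (op n)) (t : TopSimplex n),
        s (pt σ t) = K.map (stepHom t x).op σ :=
  exists_desc_fun (fun _ σ t => K.map (stepHom t x).op σ) fun f σ t => by
    rw [← Functor.map_comp_apply, ← op_comp]
    exact map_op_congr (fun i => (step_map f t (x i)).symm) σ

/-- The simplex spanned by the values at `x` of the step function of a point. -/
def sample (x : Fin (m.len + 1) →o Set.Ico (0 : ℝ) 1) : SSet.toTop.obj K → K.obj (op m) :=
  (exists_sample x).choose

theorem sample_pt (x : Fin (m.len + 1) →o Set.Ico (0 : ℝ) 1) (σ : K.obj (op n))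
    (t : TopSimplex n) : sample x (pt σ t) = K.map (stepHom t x).op σ :=
  (exists_sample x).choose_spec n σ t

theorem sample_map (x : Fin (m.len + 1) →o Set.Ico (0 : ℝ) 1) (φ : K ⟶ L)
    (a : SSet.toTop.obj K) : sample x (SSet.toTop.map φ a) = φ.app _ (sample x a) := by
  obtain ⟨n, σ, t, rfl⟩ := exists_pt a
  rw [toTop_map_pt, sample_pt, sample_pt, NatTrans.naturality_apply]

theorem TopSimplex.IsInterior.exists_stepHom_eq_id {t : TopSimplex n} (h : t.IsInterior) :
    ∃ x, stepHom t x = 𝟙 n := by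
  choose x hx using h.exists_step_eq
  refine ⟨⟨x, fun i j hij => ?_⟩, simplexHom_ext hx⟩
  by_contra! hlt
  have := (step t).monotone hlt.le
  rw [hx, hx] at this
  exact hlt.ne (congrArg x (le_antisymm this hij))

/-- Every step of an interior point is nonempty; sampling once in each step recovers the simplex. -/
theorem pt_injective {t : TopSimplex n} (h : t.IsInterior) :
    Function.Injective fun σ : K.obj (op n) => pt σ t := fun σ τ e => by
  obtain ⟨x, hx⟩ := h.exists_stepHom_eq_id
  have := congrArg (sample x) e
  simpa only [sample_pt, hx, op_id, Functor.map_id_apply] using this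

/-- Together with `pt_injective`, this is the pointwise reason why realization commutes with finite
limits. -/
theorem exists_common_pt {ι : Type*} [Finite ι] [Nonempty ι] {K : ι → SSet.{u}}
    (x : ∀ k, SSet.toTop.obj (K k)) :
    ∃ (p : SimplexCategory) (u : TopSimplex p) (σ : ∀ k, (K k).obj (op p)), u.IsInterior ∧
      ∀ k, pt (σ k) u = x k := by
  have := Fintype.ofFinite ι
  choose n σ t hx using fun k => exists_pt (x k)
  obtain ⟨p, u, α, hu, hα, -⟩ := exists_refinement n t
  exact ⟨p, u, fun k => (K k).map (α k).op (σ k), hu, fun k => by rw [pt_map, hα, hx]⟩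

theorem exists_common_pt₂ (x : SSet.toTop.obj K) (y : SSet.toTop.obj L) :
    ∃ (p : SimplexCategory) (u : TopSimplex p) (σ : K.obj (op p)) (τ : L.obj (op p)),
      u.IsInterior ∧ pt σ u = x ∧ pt τ u = y := by
  obtain ⟨p, u, σ, hu, h⟩ := exists_common_pt (ι := Bool) (K := fun b => cond b K L)
    (fun b => b.rec y x)
  exact ⟨p, u, σ true, σ false, hu, h true, h false⟩

/-- Boxes consisting of increasing sequences of numbers in `[0, 1)`. -/
structure IsBox (c d : Fin (m.len + 1) → ℝ) : Prop where
  nonneg : ∀ i, 0 ≤ c i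
  lt : ∀ i, c i < d i
  le_one : ∀ i, d i ≤ 1
  le : ∀ i j, i < j → d i ≤ c j

theorem IsBox.exists_orderHom {c d x : Fin (m.len + 1) → ℝ} (h : IsBox c d)
    (hx : ∀ i, x i ∈ Set.Ico (c i) (d i)) :
    ∃ y : Fin (m.len + 1) →o Set.Ico (0 : ℝ) 1, ∀ i, (y i : ℝ) = x i := by
  refine ⟨⟨fun i => ⟨x i, (h.nonneg i).trans (hx i).1, (hx i).2.trans_le (h.le_one i)⟩,
    fun i j hij => ?_⟩, fun i => rfl⟩
  rcases hij.eq_or_lt with rfl | hij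
  · exact le_rfl
  · exact (hx i).2.le.trans ((h.le i j hij).trans (hx j).1)

/-- The points of the box at which sampling `q` gives the simplex `τ`. -/
def sampleSet (c d : Fin (m.len + 1) → ℝ) (τ : K.obj (op m)) (q : SSet.toTop.obj K) :
    Set (Fin (m.len + 1) → ℝ) :=
  {x | (∀ i, x i ∈ Set.Ico (c i) (d i)) ∧
    ∃ y : Fin (m.len + 1) →o Set.Ico (0 : ℝ) 1, (∀ i, (y i : ℝ) = x i) ∧ sample y q = τ}

theorem sampleSet_disjoint (c d : Fin (m.len + 1) → ℝ) {τ τ' : K.obj (op m)} (h : τ ≠ τ')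
    (q : SSet.toTop.obj K) : Disjoint (sampleSet c d τ q) (sampleSet c d τ' q) := by
  refine Set.disjoint_left.2 ?_
  rintro x ⟨-, y, hy, rfl⟩ ⟨-, y', hy', rfl⟩
  refine h (congrArg (fun y => sample y q) (OrderHom.ext _ _ (funext fun i => Subtype.ext ?_)))
  rw [hy, hy']

/-- The part of `sampleSet` where the values of the step function are prescribed. -/
def stepBox (c d : Fin (m.len + 1) → ℝ) (t : TopSimplex n)
    (θ : Fin (m.len + 1) → Fin (n.len + 1)) : Set (Fin (m.len + 1) → ℝ) :=
  Set.univ.pi fun i =>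
    Set.Ico (max (c i) (∑ k with k < θ i, t k)) (min (d i) (∑ k with k ≤ θ i, t k))

theorem mem_stepBox {c d : Fin (m.len + 1) → ℝ} {t : TopSimplex n}
    {θ : Fin (m.len + 1) → Fin (n.len + 1)} {x : Fin (m.len + 1) → ℝ} :
    x ∈ stepBox c d t θ ↔ ∀ i, x i ∈ Set.Ico (c i) (d i) ∧ IsStep t (x i) (θ i) := by
  simp only [stepBox, Set.mem_univ_pi, Set.mem_Ico, max_le_iff, lt_min_iff, IsStep]
  exact forall_congr' fun i => by tauto

-- A sample depends only on the step in which each time falls, so the set of good times is a finite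
-- union of products of intervals.
open Classical in
theorem sampleSet_pt {c d : Fin (m.len + 1) → ℝ} (h : IsBox c d) (τ : K.obj (op m))
    (σ : K.obj (op n)) (t : TopSimplex n) :
    sampleSet c d τ (pt σ t) = ⋃ θ ∈ Finset.univ.filter
      fun θ : Fin (m.len + 1) → Fin (n.len + 1) =>
        ∃ f : m ⟶ n, (∀ i, f i = θ i) ∧ K.map f.op σ = τ, stepBox c d t θ := by
  ext x
  simp only [Set.mem_iUnion, Finset.mem_filter, Finset.mem_univ, true_and, exists_prop,
    mem_stepBox]
  constructor
  · rintro ⟨hx, y, hy, hs⟩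
    rw [sample_pt] at hs
    exact ⟨_, ⟨stepHom t y, fun i => rfl, hs⟩, fun i => ⟨hx i, hy i ▸ isStep_step t (y i)⟩⟩
  · rintro ⟨θ, ⟨f, hf, hs⟩, hx⟩
    obtain ⟨y, hy⟩ := h.exists_orderHom fun i => (hx i).1
    refine ⟨fun i => (hx i).1, y, hy, ?_⟩
    rw [sample_pt, ← hs]
    refine map_op_congr (fun i => ?_) σ
    rw [hf, stepHom_apply, step_eq_iff, hy]
    exact (hx i).2

theorem measurableSet_stepBox (c d : Fin (m.len + 1) → ℝ) (t : TopSimplex n)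
    (θ : Fin (m.len + 1) → Fin (n.len + 1)) : MeasurableSet (stepBox c d t θ) :=
  MeasurableSet.univ_pi fun _ => measurableSet_Ico

theorem measurableSet_sampleSet {c d : Fin (m.len + 1) → ℝ} (h : IsBox c d) (τ : K.obj (op m))
    (q : SSet.toTop.obj K) : MeasurableSet (sampleSet c d τ q) := by
  obtain ⟨n, σ, t, rfl⟩ := exists_pt q
  rw [sampleSet_pt h]
  exact Finset.measurableSet_biUnion _ fun θ _ => measurableSet_stepBox c d t θ

theorem volume_stepBox (c d : Fin (m.len + 1) → ℝ) (t : TopSimplex n)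
    (θ : Fin (m.len + 1) → Fin (n.len + 1)) :
    volume.real (stepBox c d t θ) = ∏ i,
      max (min (d i) (∑ k with k ≤ θ i, t k) - max (c i) (∑ k with k < θ i, t k)) 0 := by
  rw [measureReal_def, stepBox, volume_pi_pi, ENNReal.toReal_prod]
  simp [ENNReal.toReal_ofReal']

theorem volume_stepBox_ne_top (c d : Fin (m.len + 1) → ℝ) (t : TopSimplex n)
    (θ : Fin (m.len + 1) → Fin (n.len + 1)) : volume (stepBox c d t θ) ≠ ⊤ := by
  rw [stepBox, volume_pi_pi]
  exact ENNReal.prod_ne_top fun i _ => by simp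

/-- On each simplex the volume is a sum over disjoint boxes whose side lengths are continuous in the
coordinates. -/
theorem continuous_volume_sampleSet {c d : Fin (m.len + 1) → ℝ} (h : IsBox c d)
    (τ : K.obj (op m)) : Continuous fun q => volume.real (sampleSet c d τ q) := by
  classical
  refine continuous_iff_pt.2 fun n σ => ?_
  have : ∀ t : TopSimplex n, volume.real (sampleSet c d τ (pt σ t)) = ∑ θ ∈ Finset.univ.filter
      fun θ : Fin (m.len + 1) → Fin (n.len + 1) =>
        ∃ f : m ⟶ n, (∀ i, f i = θ i) ∧ K.map f.op σ = τ, volume.real (stepBox c d t θ) := by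
    intro t
    rw [sampleSet_pt h, measureReal_biUnion_finset _ _ fun θ _ => volume_stepBox_ne_top c d t θ]
    · intro θ _ θ' _ hne
      refine Set.disjoint_left.2 fun x hx hx' => hne (funext fun i => ?_)
      exact (mem_stepBox.1 hx i).2.unique (mem_stepBox.1 hx' i).2
    · exact fun θ _ => measurableSet_stepBox c d t θ
  simp_rw [this, volume_stepBox]
  have ht : ∀ k, Continuous fun t : TopSimplex n => t k := fun k =>
    (continuous_apply k).comp continuous_subtype_val
  fun_prop

theorem volume_box {c d : Fin (m.len + 1) → ℝ} (h : IsBox c d) :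
    volume.real (Set.univ.pi fun i => Set.Ico (c i) (d i)) = ∏ i, (d i - c i) := by
  rw [measureReal_def, volume_pi_pi, ENNReal.toReal_prod]
  exact Finset.prod_congr rfl fun i _ => by
    rw [Real.volume_Ico, ENNReal.toReal_ofReal (sub_nonneg.2 (h.lt i).le)]

theorem IsBox.volume_pos {c d : Fin (m.len + 1) → ℝ} (h : IsBox c d) :
    0 < ∏ i, (d i - c i) :=
  Finset.prod_pos fun i _ => sub_pos.2 (h.lt i)

theorem sampleSet_subset (c d : Fin (m.len + 1) → ℝ) (τ : K.obj (op m))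
    (q : SSet.toTop.obj K) : sampleSet c d τ q ⊆ Set.univ.pi fun i => Set.Ico (c i) (d i) :=
  fun _ hx i _ => hx.1 i

/-- More than half of the samples of `q` in the box give the simplex `τ`. -/
def majority (c d : Fin (m.len + 1) → ℝ) (τ : K.obj (op m)) : Set (SSet.toTop.obj K) :=
  {q | (∏ i, (d i - c i)) / 2 < volume.real (sampleSet c d τ q)}

theorem isOpen_majority {c d : Fin (m.len + 1) → ℝ} (h : IsBox c d) (τ : K.obj (op m)) :
    IsOpen (majority c d τ) :=
  isOpen_lt continuous_const (continuous_volume_sampleSet h τ)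

/-- Two subsets of a box that each fill more than half of it must meet. The two points may lie in
different realizations. -/
theorem exists_mem_sampleSet_of_majority {c d : Fin (m.len + 1) → ℝ} (h : IsBox c d)
    {τ : K.obj (op m)} {τ' : L.obj (op m)} {q : SSet.toTop.obj K} {q' : SSet.toTop.obj L}
    (hq : q ∈ majority c d τ) (hq' : q' ∈ majority c d τ') :
    ∃ x, x ∈ sampleSet c d τ q ∧ x ∈ sampleSet c d τ' q' := by
  by_contra! hx
  have hd : Disjoint (sampleSet c d τ q) (sampleSet c d τ' q') := Set.disjoint_left.2 hx
  have hb : volume (Set.univ.pi fun i => Set.Ico (c i) (d i)) ≠ ⊤ := by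
    rw [volume_pi_pi]
    exact ENNReal.prod_ne_top fun i _ => by simp
  have h1 := measureReal_union hd (measurableSet_sampleSet h τ' q')
    (μ := volume) (ne_top_of_le_ne_top hb (measure_mono (sampleSet_subset c d τ q)))
    (ne_top_of_le_ne_top hb (measure_mono (sampleSet_subset c d τ' q')))
  have h2 := measureReal_mono (μ := volume)
    (Set.union_subset (sampleSet_subset c d τ q) (sampleSet_subset c d τ' q')) hb
  rw [volume_box h] at h2
  simp only [majority, Set.mem_ofPred_eq] at hq hq'
  linarith

theorem eq_of_majority {c d : Fin (m.len + 1) → ℝ} (h : IsBox c d) {τ τ' : K.obj (op m)}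
    {q : SSet.toTop.obj K} (hq : q ∈ majority c d τ) (hq' : q ∈ majority c d τ') : τ = τ' := by
  by_contra hne
  obtain ⟨x, hx, hx'⟩ := exists_mem_sampleSet_of_majority h hq hq'
  exact Set.disjoint_left.1 (sampleSet_disjoint c d hne q) hx hx'

/-- The box of all sequences whose `i`-th member lies in the `i`-th step. -/
theorem TopSimplex.IsInterior.isBox {u : TopSimplex n} (hu : u.IsInterior) :
    IsBox (fun j => ∑ i with i < j, u i) (fun j => ∑ i with i ≤ j, u i) where
  nonneg j := Finset.sum_nonneg fun i _ => stdSimplex.zero_le u i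
  lt j := by rw [u.sum_le]; linarith [hu j]
  le_one j := by simpa using u.sum_mono (p := (· ≤ j)) (q := fun _ => True) fun _ _ => trivial
  le i j hij := u.sum_mono fun k hk => hk.trans_lt hij

theorem mem_majority_of_forall {c d : Fin (m.len + 1) → ℝ} (h : IsBox c d) {τ : K.obj (op m)}
    {q : SSet.toTop.obj K} (H : ∀ y : Fin (m.len + 1) →o Set.Ico (0 : ℝ) 1,
      (∀ i, (y i : ℝ) ∈ Set.Ico (c i) (d i)) → sample y q = τ) : q ∈ majority c d τ := by
  have : sampleSet c d τ q = Set.univ.pi fun j => Set.Ico (c j) (d j) := by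
    refine (sampleSet_subset _ _ _ _).antisymm fun x hx => ⟨fun i => hx i trivial, ?_⟩
    obtain ⟨y, hy⟩ := h.exists_orderHom fun i => hx i trivial
    exact ⟨y, hy, H y fun i => by rw [hy]; exact hx i trivial⟩
  rw [majority, Set.mem_ofPred_eq, this, volume_box h]
  linarith [h.volume_pos]

theorem pt_mem_majority {u : TopSimplex n} (hu : u.IsInterior) (σ : K.obj (op n)) :
    pt σ u ∈ majority (fun j => ∑ i with i < j, u i) (fun j => ∑ i with i ≤ j, u i) σ :=
  mem_majority_of_forall hu.isBox fun y hy => by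
    have : stepHom u y = 𝟙 n := simplexHom_ext fun i => step_eq_iff.2 (hy i)
    rw [sample_pt, this, op_id, Functor.map_id_apply]

/-- Distinct points are given by distinct simplices `σ`, `τ` over one interior `u`. Sampling once in
each step of `u` returns `σ` and `τ`, and no point can have a majority for both. -/
instance : T2Space (SSet.toTop.obj K) where
  t2 x y hxy := by
    obtain ⟨p, u, σ, τ, hu, rfl, rfl⟩ := exists_common_pt₂ x y
    have hne : σ ≠ τ := fun h => hxy (h ▸ rfl)
    exact ⟨_, _, isOpen_majority hu.isBox σ, isOpen_majority hu.isBox τ, pt_mem_majority hu σ,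
      pt_mem_majority hu τ, Set.disjoint_left.2 fun q hq hq' =>
        hne (eq_of_majority hu.isBox hq hq')⟩

end Sampling

/-! ### Compact subsets of the realization -/

section Compact

variable {K : SSet.{u}} {m n : SimplexCategory}

theorem exists_section {f : m ⟶ n} (h : Function.Surjective f) : ∃ g : n ⟶ m, g ≫ f = 𝟙 n := by
  have : Epi f := SimplexCategory.epi_iff_surjective.2 h
  have := isSplitEpi_of_epi f
  exact ⟨section_ f, IsSplitEpi.id f⟩

/-- Two representations of the same point are compatible after a common refinement. -/
theorem exists_common_refinement {σ : K.obj (op m)} {s : TopSimplex m} {τ : K.obj (op n)}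
    {t : TopSimplex n} (h : pt σ s = pt τ t) :
    ∃ (p : SimplexCategory) (w : TopSimplex p) (γ : p ⟶ m) (δ : p ⟶ n), w.IsInterior ∧
      TopSimplex.map γ w = s ∧ TopSimplex.map δ w = t ∧ K.map γ.op σ = K.map δ.op τ := by
  obtain ⟨p, w, α, hw, hα, -⟩ := exists_refinement (ι := Bool) (fun b => cond b m n)
    (fun b => b.rec t s)
  refine ⟨p, w, α true, α false, hw, hα true, hα false, pt_injective hw ?_⟩
  simp only [pt_map]
  rw [show TopSimplex.map (α true) w = s from hα true,
    show TopSimplex.map (α false) w = t from hα false, h]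

/-- A representation of minimal dimension among the interior ones is a pullback of every other
representation of the same point. -/
theorem exists_carrier (x : SSet.toTop.obj K) :
    ∃ c : Σ n : SimplexCategory, K.obj (op n), (∃ t : TopSimplex c.1, pt c.2 t = x) ∧
      ∀ (m : SimplexCategory) (τ : K.obj (op m)) (s : TopSimplex m), pt τ s = x →
        c.1.len ≤ m.len ∧ ∃ η : c.1 ⟶ m, c.2 = K.map η.op τ := by
  classical
  have hex : ∀ (m : SimplexCategory) (τ : K.obj (op m)) (s : TopSimplex m), pt τ s = x →
      ∃ (n : SimplexCategory) (σ : K.obj (op n)) (t : TopSimplex n), n.len ≤ m.len ∧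
        t.IsInterior ∧ pt σ t = x := by
    intro m τ s h
    -- Refining a single point discards its empty steps: it becomes interior and the dimension does
    -- not grow.
    obtain ⟨p, u, α, hu, hα, hp⟩ := exists_refinement (ι := Unit) (fun _ => m) (fun _ => s)
    refine ⟨p, K.map (α ()).op τ, u, by simpa using hp, hu, ?_⟩
    rw [pt_map, hα, h]
  have hmin : ∃ k, ∃ (n : SimplexCategory) (σ : K.obj (op n)) (t : TopSimplex n), n.len = k ∧
        t.IsInterior ∧ pt σ t = x := by
    obtain ⟨m, τ, s, h⟩ := exists_pt x
    obtain ⟨n, σ, t, -, ht, h⟩ := hex m τ s h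
    exact ⟨_, n, σ, t, rfl, ht, h⟩
  obtain ⟨n, σ, t, hn, ht, hx⟩ := Nat.find_spec hmin
  refine ⟨⟨n, σ⟩, ⟨t, hx⟩, fun m τ s h => ⟨?_, ?_⟩⟩
  · obtain ⟨n', σ', t', hn', ht', hx'⟩ := hex m τ s h
    exact hn.trans_le ((Nat.find_min' hmin ⟨n', σ', t', rfl, ht', hx'⟩).trans hn')
  · obtain ⟨p, w, γ, δ, hw, rfl, -, he⟩ := exists_common_refinement (hx.trans h.symm)
    -- The map `γ` of the common refinement is onto because it carries `w` to an interior point; a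
    -- section of it expresses `σ` through `τ`.
    obtain ⟨ε, hε⟩ := exists_section ht.surjective
    refine ⟨ε ≫ δ, ?_⟩
    have := congrArg (K.map ε.op) he
    rwa [← Functor.map_comp_apply, ← Functor.map_comp_apply, ← op_comp, hε, op_id,
      Functor.map_id_apply, ← op_comp] at this

/-- A compact subset is contained in a finite union of simplices. -/
theorem exists_finite_cover {S : Set (SSet.toTop.obj K)} (hS : IsCompact S) :
    ∃ F : Set (Σ n : SimplexCategory, K.obj (op n)), F.Finite ∧
      ∀ x ∈ S, ∃ c ∈ F, ∃ t, pt c.2 t = x := by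
  choose c hc hface using exists_carrier (K := K)
  refine ⟨c '' S, ?_, fun x hx => ⟨_, Set.mem_image_of_mem _ hx, hc x⟩⟩
  -- `D` contains one point of `S` per carrier. A given simplex has only finitely many pullbacks of
  -- dimension at most its own, so it meets `D` in finitely many points. Hence all subsets of `D`
  -- are closed, and `D` is compact and discrete.
  obtain ⟨D, hDS, hinj, hD⟩ : ∃ D ⊆ S, Set.InjOn c D ∧ c '' D = c '' S := by
    obtain ⟨D, hD, hDc⟩ := Set.SurjOn.exists_bijOn_subset (Set.surjOn_image c S)
    exact ⟨D, hD, hDc.injOn, hDc.image_eq⟩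
  rw [← hD]
  refine Set.Finite.image c ?_
  have hclosed : ∀ D' ⊆ D, IsClosed D' := fun D' hD' => isClosed_iff_pt.2 fun m τ => by
    have hfin : (D' ∩ Set.range (pt τ)).Finite := by
      refine Set.Finite.of_finite_image (f := c) ?_ (hinj.mono (Set.inter_subset_left.trans hD'))
      refine (Set.finite_range fun z : Σ k : Fin (m.len + 1), (⦋(k : ℕ)⦌ ⟶ m) =>
        (⟨_, K.map z.2.op τ⟩ : Σ n : SimplexCategory, K.obj (op n))).subset ?_
      rintro _ ⟨x, ⟨-, t, ht⟩, rfl⟩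
      obtain ⟨hle, η, hη⟩ := hface x m τ t ht
      exact ⟨⟨⟨(c x).1.len, Nat.lt_succ_of_le hle⟩, η⟩, Sigma.ext rfl (heq_of_eq hη.symm)⟩
    have : pt τ ⁻¹' D' = pt τ ⁻¹' (D' ∩ Set.range (pt τ)) := by simp
    rw [this]
    exact hfin.isClosed.preimage (continuous_pt τ)
  refine (hS.of_isClosed_subset (hclosed D subset_rfl) hDS).finite ?_
  exact isDiscrete_iff_forall_mem_exists_isClosed.2 fun s hs =>
    ⟨s, hclosed s hs, Set.inter_eq_left.2 hs⟩

end Compact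

/-! ### Jointly injective families -/

section JointlyInjective

variable {ι : Type*} {A : SSet.{u}} {K : ι → SSet.{u}}

/-- Families of simplicial maps which are jointly injective on simplices. -/
def JointlyInjective (p : ∀ k, A ⟶ K k) : Prop :=
  ∀ (n : SimplexCategory) (σ τ : A.obj (op n)),
    (∀ k, (p k).app _ σ = (p k).app _ τ) → σ = τ

variable {p : ∀ k, A ⟶ K k} (hp : JointlyInjective p)
include hp

/-- Represent both points over one interior `u`; equality of the images then becomes equality of the
images of the simplices. -/
theorem JointlyInjective.eq {a b : SSet.toTop.obj A}
    (h : ∀ k, SSet.toTop.map (p k) a = SSet.toTop.map (p k) b) : a = b := by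
  obtain ⟨n, u, σ, τ, hu, rfl, rfl⟩ := exists_common_pt₂ a b
  refine congrArg (fun σ => pt σ u) (hp n σ τ fun k => pt_injective hu ?_)
  simpa only [toTop_map_pt] using h k

/-- Each `S k` lies in finitely many simplices. The refinements needed to compare them have bounded
dimension, and a simplex of `A` is determined by its images; so finitely many simplices of `A`
suffice. -/
theorem JointlyInjective.exists_compact [Finite ι] {S : ∀ k, Set (SSet.toTop.obj (K k))}
    (hS : ∀ k, IsCompact (S k)) :
    ∃ Q : Set (SSet.toTop.obj A), IsCompact Q ∧
      ∀ a, (∀ k, SSet.toTop.map (p k) a ∈ S k) → a ∈ Q := by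
  rcases isEmpty_or_nonempty ι with hι | hι
  · refine ⟨Set.univ, ?_, fun _ _ => trivial⟩
    have : Subsingleton (SSet.toTop.obj A) := ⟨fun a b => hp.eq fun k => isEmptyElim k⟩
    exact Set.subsingleton_univ.isCompact
  have := Fintype.ofFinite ι
  choose F hF hcov using fun k => exists_finite_cover (hS k)
  have hFin : ∀ k, Finite (F k) := fun k => (hF k).to_subtype
  let T (f : ∀ k, F k) (q : SimplexCategory) (α : ∀ k, q ⟶ (f k).1.1) :
      Set (Σ n : SimplexCategory, A.obj (op n)) :=
    {c | ∃ a : A.obj (op q), c = ⟨q, a⟩ ∧ ∀ k, (p k).app _ a = (K k).map (α k).op (f k).1.2}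
  have hT : (⋃ (f : ∀ k, F k) (r : Fin (∏ k, ((f k).1.1.len + 1)))
      (α : ∀ k, (⦋(r : ℕ)⦌ : SimplexCategory) ⟶ (f k).1.1), T f ⦋(r : ℕ)⦌ α).Finite := by
    refine Set.finite_iUnion fun f => Set.finite_iUnion fun r => Set.finite_iUnion fun α =>
      Set.Subsingleton.finite ?_
    rintro _ ⟨a, rfl, ha⟩ _ ⟨b, rfl, hb⟩
    rw [hp _ a b fun k => (ha k).trans (hb k).symm]
  refine ⟨_, hT.isCompact_biUnion (f := fun c => Set.range (pt c.2)) fun c _ => ?_,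
    fun a ha => ?_⟩
  · have : CompactSpace (TopSimplex c.1) := isCompact_iff_compactSpace.1 (isCompact_stdSimplex ℝ _)
    exact isCompact_range (continuous_pt c.2)
  choose f hf t ht using fun k => hcov k _ (ha k)
  obtain ⟨q, u, α, hu, hα, hq⟩ := exists_refinement (fun k => (f k).1) t
  obtain ⟨n, a₀, v, rfl⟩ := exists_pt a
  obtain ⟨r, w, β, hw, hβ, -⟩ := exists_refinement (ι := Bool) (fun b => cond b n q)
    (fun b => b.rec u v)
  obtain ⟨δ, hδ⟩ : ∃ δ, δ = β false := ⟨_, rfl⟩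
  have hv : TopSimplex.map (β true) w = v := hβ true
  have hδu : TopSimplex.map δ w = u := by rw [hδ]; exact hβ false
  have hs : Function.Surjective δ := TopSimplex.IsInterior.surjective (t := w) (hδu ▸ hu)
  obtain ⟨ε, hε⟩ := exists_section hs
  have hk (k) : (p k).app _ (A.map (β true).op a₀) = (K k).map (δ ≫ α k).op (f k).2 := by
    refine pt_injective hw ?_
    change pt _ w = pt _ w
    rw [NatTrans.naturality_apply, pt_map, hv, op_comp, Functor.map_comp_apply, pt_map, pt_map,
      hδu, hα, ht, toTop_map_pt]
    rfl
  have hk' (k) : (p k).app _ (A.map (ε ≫ β true).op a₀) = (K k).map (α k).op (f k).2 := by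
    rw [op_comp, Functor.map_comp_apply, NatTrans.naturality_apply, hk, ← Functor.map_comp_apply,
      ← op_comp, ← Category.assoc, hε, Category.id_comp]
  -- Each image of the refined simplex comes from [q] along `δ`. By joint injectivity so does the
  -- simplex itself, and therefore `a` lies on a simplex of the bounded dimension `q.len`.
  have ha' : A.map δ.op (A.map (ε ≫ β true).op a₀) = A.map (β true).op a₀ := hp _ _ _ fun k => by
    rw [NatTrans.naturality_apply, hk', hk, op_comp, Functor.map_comp_apply]
  refine Set.mem_biUnion (x := ⟨q, A.map (ε ≫ β true).op a₀⟩) ?_ ⟨u, ?_⟩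
  · simp only [Set.mem_iUnion]
    exact ⟨fun k => ⟨f k, hf k⟩, ⟨q.len, hq⟩, α, _, rfl, hk'⟩
  · change pt _ u = _
    rw [← hδu, ← pt_map, ha', pt_map, hv]

/-- Continuity of maps from compact spaces can be tested on a jointly injective finite family. -/
theorem JointlyInjective.continuous [Finite ι] {S : Type*} [TopologicalSpace S] [CompactSpace S]
    {h : S → SSet.toTop.obj A} (hh : ∀ k, Continuous fun s => SSet.toTop.map (p k) (h s)) :
    Continuous h := by
  obtain ⟨Q, hQ, hmem⟩ := hp.exists_compact fun k => isCompact_range (hh k)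
  have : CompactSpace Q := isCompact_iff_compactSpace.1 hQ
  let j (a : Q) (k : ι) : SSet.toTop.obj (K k) := SSet.toTop.map (p k) a.1
  -- A continuous injection from a compact space to a Hausdorff space, so continuity into `Q` is
  -- continuity of the components.
  have hj : IsClosedEmbedding j := by
    refine Continuous.isClosedEmbedding ?_ fun a b e => Subtype.ext (hp.eq fun k => congrFun e k)
    exact continuous_pi fun k => (SSet.toTop.map (p k)).hom.continuous.comp continuous_subtype_val
  have hc : Continuous fun s => (⟨h s, hmem _ fun k => ⟨s, rfl⟩⟩ : Q) :=
    hj.isEmbedding.continuous_iff.2 (continuous_pi hh)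
  exact continuous_subtype_val.comp hc

end JointlyInjective

/-! ### Coverings -/

section Coverings

open MeasureTheory

variable {K L : SSet.{u}} {m n : SimplexCategory}

/-- The inclusion of the `i`-th vertex. -/
abbrev vertexHom (n : SimplexCategory) (i : Fin (n.len + 1)) : (⦋0⦌ : SimplexCategory) ⟶ n :=
  SimplexCategory.const ⦋0⦌ n i

/-- Coverings of simplicial sets: every simplex of the base has a unique lift with prescribed
`i`-th vertex. -/
def IsSimplicialCovering (p : K ⟶ L) : Prop :=
  ∀ (n : SimplexCategory) (i : Fin (n.len + 1)) (τ : L.obj (op n)) (w : K.obj (op ⦋0⦌)),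
    p.app _ w = L.map (vertexHom n i).op τ →
      ∃! κ : K.obj (op n), p.app _ κ = τ ∧ K.map (vertexHom n i).op κ = w

theorem map_vertexHom (f : m ⟶ n) (i : Fin (m.len + 1)) (σ : K.obj (op n)) :
    K.map (vertexHom m i).op (K.map f.op σ) = K.map (vertexHom n (f i)).op σ := by
  rw [← Functor.map_comp_apply, ← op_comp]
  exact map_op_congr (fun j => rfl) σ

theorem sample_comp (θ : m ⟶ n) (y : Fin (n.len + 1) →o Set.Ico (0 : ℝ) 1)
    (a : SSet.toTop.obj K) :
    sample (y.comp θ.toOrderHom) a = K.map θ.op (sample y a) := by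
  obtain ⟨r, σ, t, rfl⟩ := exists_pt a
  rw [sample_pt, sample_pt, ← Functor.map_comp_apply, ← op_comp]
  exact map_op_congr (fun j => rfl) σ

theorem sample_vertex_pt (y : Fin 1 →o Set.Ico (0 : ℝ) 1) (σ : K.obj (op n))
    (t : TopSimplex n) :
    sample (m := ⦋0⦌) y (pt σ t) = K.map (vertexHom n (step t (y 0))).op σ := by
  rw [sample_pt]
  refine map_op_congr (fun j => ?_) σ
  obtain rfl := Subsingleton.elim (α := Fin 1) j 0
  rfl

namespace IsSimplicialCovering

variable {p : K ⟶ L} (hp : IsSimplicialCovering p)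
include hp

theorem eq_of_vertex {κ κ' : K.obj (op n)} (h : p.app _ κ = p.app _ κ') (i : Fin (n.len + 1))
    (hi : K.map (vertexHom n i).op κ = K.map (vertexHom n i).op κ') : κ = κ' :=
  (hp n i (p.app _ κ') (K.map (vertexHom n i).op κ') (NatTrans.naturality_apply _ _ _)).unique
    ⟨h, hi⟩ ⟨rfl, rfl⟩

/-- The lift of `τ` is pinned down at the vertex `δ 0`, which is the image of vertex 0 of a common
refinement; uniqueness of lifts identifies the two refined simplices. -/
theorem exists_lift {a : SSet.toTop.obj K} {τ : L.obj (op n)} {t : TopSimplex n}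
    (h : SSet.toTop.map p a = pt τ t) : ∃ κ : K.obj (op n), p.app _ κ = τ ∧ pt κ t = a := by
  obtain ⟨m, κ', s, rfl⟩ := exists_pt a
  rw [toTop_map_pt] at h
  obtain ⟨r, w, γ, δ, -, rfl, rfl, he⟩ := exists_common_refinement h
  obtain ⟨κ, ⟨hκ, hv⟩, -⟩ := hp n (δ 0) τ (K.map (vertexHom r 0).op (K.map γ.op κ')) (by
    rw [NatTrans.naturality_apply, NatTrans.naturality_apply, he, map_vertexHom])
  refine ⟨κ, hκ, ?_⟩
  rw [← pt_map, ← pt_map]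
  congr 1
  refine hp.eq_of_vertex ?_ 0 ?_
  · rw [NatTrans.naturality_apply, NatTrans.naturality_apply, he, hκ]
  · rw [← hv, map_vertexHom]

/-- With `exists_of_sample`, this identifies the fibre over `q` with the vertices over the sample of
`q` at a single time. -/
theorem eq_of_sample {k k' : SSet.toTop.obj K} (h : SSet.toTop.map p k = SSet.toTop.map p k')
    (y : Fin 1 →o Set.Ico (0 : ℝ) 1) (hy : sample (m := ⦋0⦌) y k = sample (m := ⦋0⦌) y k') :
    k = k' := by
  obtain ⟨n, u, κ, κ', hu, rfl, rfl⟩ := exists_common_pt₂ k k'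
  rw [toTop_map_pt, toTop_map_pt] at h
  rw [sample_vertex_pt, sample_vertex_pt] at hy
  rw [hp.eq_of_vertex (pt_injective hu h) _ hy]

theorem exists_of_sample {q : SSet.toTop.obj L} (y : Fin 1 →o Set.Ico (0 : ℝ) 1)
    {w : K.obj (op ⦋0⦌)} (hw : p.app _ w = sample (m := ⦋0⦌) y q) :
    ∃ k, SSet.toTop.map p k = q ∧ sample (m := ⦋0⦌) y k = w := by
  obtain ⟨n, τ, t, rfl⟩ := exists_pt q
  rw [sample_vertex_pt] at hw
  obtain ⟨κ, ⟨hκ, hv⟩, -⟩ := hp n _ τ w hw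
  exact ⟨pt κ t, by rw [toTop_map_pt, hκ], by rw [sample_vertex_pt, hv]⟩

/-- By `exists_lift`, the trace of the image on the simplex `τ` is the union of the traces of `W` on
all lifts of `τ`. -/
theorem isOpenMap : IsOpenMap (SSet.toTop.map p) := fun W hW => isOpen_iff_pt.2 fun n τ => by
  have : pt τ ⁻¹' (SSet.toTop.map p '' W) =
      ⋃ κ ∈ {κ | p.app (op n) κ = τ}, pt κ ⁻¹' W := by
    ext t
    simp only [Set.mem_preimage, Set.mem_image, Set.mem_iUnion, Set.mem_ofPred_eq, exists_prop]
    constructor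
    · rintro ⟨a, ha, h⟩
      obtain ⟨κ, hκ, rfl⟩ := hp.exists_lift h
      exact ⟨κ, hκ, ha⟩
    · rintro ⟨κ, hκ, h⟩
      exact ⟨_, h, by rw [toTop_map_pt, hκ]⟩
  rw [this]
  exact isOpen_biUnion fun κ _ => hW.preimage (continuous_pt κ)

/-- If the sample of `p k` on `y` is a degenerate edge, then so is that of `k`. -/
theorem sample_eq_of_degenerate {k : SSet.toTop.obj K} {v : L.obj (op ⦋0⦌)}
    (y : Fin 2 →o Set.Ico (0 : ℝ) 1)
    (h : sample (m := ⦋1⦌) y (SSet.toTop.map p k) =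
      L.map (SimplexCategory.const ⦋1⦌ ⦋0⦌ 0).op v) :
    K.map (vertexHom ⦋1⦌ 0).op (sample (m := ⦋1⦌) y k) =
      K.map (vertexHom ⦋1⦌ 1).op (sample (m := ⦋1⦌) y k) := by
  rw [sample_map] at h
  have key : sample (m := ⦋1⦌) y k = K.map (SimplexCategory.const ⦋1⦌ ⦋0⦌ 0).op
      (K.map (vertexHom ⦋1⦌ 1).op (sample (m := ⦋1⦌) y k)) := by
    refine hp.eq_of_vertex ?_ 1 ?_
    · rw [NatTrans.naturality_apply, NatTrans.naturality_apply, h, ← Functor.map_comp_apply,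
        ← Functor.map_comp_apply, ← op_comp, ← op_comp]
      exact map_op_congr (fun j => rfl) v
    · rw [map_vertexHom, ← Functor.map_comp_apply, ← op_comp]
      exact map_op_congr (fun j => rfl) _
  conv_lhs => rw [key]
  rw [map_vertexHom, ← Functor.map_comp_apply, ← op_comp]
  exact map_op_congr (fun j => rfl) _

end IsSimplicialCovering

/-- The first half of the interval `[0, d)`, as a box. -/
theorem isBox_half {d : ℝ} (hd : 0 < d) (hd1 : d ≤ 1) :
    IsBox (m := ⦋0⦌) (fun _ => 0) (fun _ => d / 2) where
  nonneg _ := le_rfl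
  lt _ := by linarith
  le_one _ := by linarith
  le i j h := absurd h (by rw [Subsingleton.elim (α := Fin 1) i j]; exact lt_irrefl _)

/-- The product of the two halves of the interval `[0, d)`, as a box. -/
theorem isBox_halves {d : ℝ} (hd : 0 < d) (hd1 : d ≤ 1) :
    IsBox (m := ⦋1⦌) (![0, d / 2] : Fin 2 → ℝ) (![d / 2, d] : Fin 2 → ℝ) where
  nonneg := by rw [Fin.forall_fin_two]; simp; linarith
  lt := by rw [Fin.forall_fin_two]; simp; linarith
  le_one := by rw [Fin.forall_fin_two]; simp; constructor <;> linarith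
  le := by
    simp only [SimplexCategory.len_mk]
    rw [Fin.forall_fin_two, Fin.forall_fin_two, Fin.forall_fin_two]
    simp

/-- Fubini: if every slice filled at most half of the first interval, the whole set would fill at
most half of the box. It fixes one second time that works for most first times. -/
theorem exists_slice {d : ℝ} (hd : 0 < d) (hd1 : d ≤ 1) {e : L.obj (op ⦋1⦌)}
    {q : SSet.toTop.obj L}
    (hq : q ∈ majority (m := ⦋1⦌) (![0, d / 2] : Fin 2 → ℝ) (![d / 2, d] : Fin 2 → ℝ) e) :
    ∃ x' ∈ Set.Ico (d / 2) d, d / 2 / 2 < volume.real ((fun x : Fin 1 → ℝ =>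
      (![x 0, x'] : Fin 2 → ℝ)) ⁻¹'
        sampleSet (m := ⦋1⦌) (![0, d / 2] : Fin 2 → ℝ) (![d / 2, d] : Fin 2 → ℝ) e q) := by
  set S : Set (Fin 2 → ℝ) :=
    sampleSet (m := ⦋1⦌) (![0, d / 2] : Fin 2 → ℝ) (![d / 2, d] : Fin 2 → ℝ) e q with hS
  have hSm : MeasurableSet S := measurableSet_sampleSet (isBox_halves hd hd1) e q
  by_contra! H
  let ε := MeasurableEquiv.piFinSuccAbove (fun _ : Fin 2 => ℝ) 1
  have hε : ∀ (x' : ℝ) (x : Fin 1 → ℝ), ε.symm (x', x) = ![x 0, x'] := fun x' x => by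
    ext i
    fin_cases i <;> rfl
  have hslice : ∀ x' : ℝ, volume (Prod.mk x' ⁻¹' (ε.symm ⁻¹' S)) ≤
      (Set.Ico (d / 2) d).indicator (fun _ => ENNReal.ofReal (d / 2 / 2)) x' := by
    intro x'
    have heq : Prod.mk x' ⁻¹' (ε.symm ⁻¹' S) =
        (fun x : Fin 1 → ℝ => (![x 0, x'] : Fin 2 → ℝ)) ⁻¹' S := by
      ext x
      simp only [Set.mem_preimage, hε]
    rw [heq]
    by_cases hx : x' ∈ Set.Ico (d / 2) d
    · rw [Set.indicator_of_mem hx]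
      refine (ENNReal.le_ofReal_iff_toReal_le ?_ (by linarith)).2 (H x' hx)
      refine ne_top_of_le_ne_top ?_ (measure_mono (t := Set.univ.pi fun _ => Set.Ico 0 (d / 2))
        fun x hx i _ => ?_)
      · rw [volume_pi_pi]
        exact ENNReal.prod_ne_top fun i _ => by simp
      · obtain rfl := Subsingleton.elim i 0
        exact hx.1 0
    · rw [Set.indicator_of_notMem hx]
      refine le_of_eq (measure_mono_null (t := ∅) (fun x h => hx ?_) (by simp))
      exact h.1 1
  have h1 : volume S ≤ ENNReal.ofReal (d / 2 / 2) * ENNReal.ofReal (d - d / 2) := by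
    have hpre := (volume_preserving_piFinSuccAbove (fun _ : Fin 2 => ℝ) 1).symm.measure_preimage
      hSm.nullMeasurableSet
    rw [← hpre]
    calc volume (ε.symm ⁻¹' S) = ∫⁻ x', volume (Prod.mk x' ⁻¹' (ε.symm ⁻¹' S)) :=
          Measure.prod_apply (ε.symm.measurable hSm)
      _ ≤ ∫⁻ x', (Set.Ico (d / 2) d).indicator (fun _ => ENNReal.ofReal (d / 2 / 2)) x' :=
          lintegral_mono hslice
      _ = _ := by
          rw [lintegral_indicator measurableSet_Ico, setLIntegral_const, Real.volume_Ico]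
  rw [← ENNReal.ofReal_mul (by linarith)] at h1
  have h2 := ENNReal.toReal_le_of_le_ofReal (by nlinarith) h1
  have h3 : (d / 2) * (d - d / 2) / 2 < volume.real S := by
    have := hq
    simp only [majority, Set.mem_ofPred_eq, SimplexCategory.len_mk] at this
    rw [Fin.prod_univ_two] at this
    simpa using this
  rw [measureReal_def] at h3
  linarith

/-- Near a point whose first step has value `v`, sheets are indexed by the vertices `w` over `v`: a
point belongs to the sheet `w` if it takes the value `w` most of the time early in that step. -/
theorem IsSimplicialCovering.isCoveringMap {p : K ⟶ L} (hp : IsSimplicialCovering p) :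
    IsCoveringMap (SSet.toTop.map p) := fun q₀ => by
  obtain ⟨n, u, τ, -, hu, rfl, -⟩ := exists_common_pt₂ q₀ q₀
  set d := u 0 with hd
  have hd0 : 0 < d := hu 0
  have hd1 : d ≤ 1 := stdSimplex.le_one u 0
  let v := L.map (vertexHom n 0).op τ
  let e := L.map (SimplexCategory.const ⦋1⦌ ⦋0⦌ 0).op v
  have he : e = L.map (SimplexCategory.const ⦋1⦌ ⦋0⦌ 0 ≫ vertexHom n 0).op τ := by
    rw [op_comp, Functor.map_comp_apply]
  -- A majority for the vertex `v` would not do: lifts could change their vertex along a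
  -- nondegenerate loop at `v`. A majority for the degenerate edge excludes this.
  let U := majority (m := ⦋1⦌) (![0, d / 2] : Fin 2 → ℝ) (![d / 2, d] : Fin 2 → ℝ) e
  let V (w : {w : K.obj (op ⦋0⦌) // p.app _ w = v}) :=
    majority (m := ⦋0⦌) (fun _ => 0) (fun _ => d / 2) w.1
  have hU : IsOpen U := isOpen_majority (isBox_halves hd0 hd1) e
  have hV (w) : IsOpen (V w) := isOpen_majority (isBox_half hd0 hd1) w.1
  have hq₀ : pt τ u ∈ U := mem_majority_of_forall (isBox_halves hd0 hd1) fun y hy => by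
    rw [sample_pt, he]
    refine map_op_congr (fun i => step_eq_iff.2 ?_) τ
    have h0 : IsStep u (y i) 0 ↔ (y i : ℝ) ∈ Set.Ico 0 d := by
      rw [← Set.mem_ofPred_eq (p := fun x => IsStep u x 0), setOf_isStep_eq_Ico]
      simp [hd, Finset.filter_eq']
    refine h0.2 ⟨(y i).2.1, ?_⟩
    have hi := (hy i).2
    revert hi
    obtain rfl | rfl : i = (0 : Fin 2) ∨ i = (1 : Fin 2) := Fin.exists_fin_two.1 ⟨i, rfl⟩
    · simp; intro h; linarith
    · simp
  have inj (w) : (V w).InjOn (SSet.toTop.map p) := fun k hk k' hk' h => by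
    obtain ⟨x, ⟨-, y, hy, hs⟩, ⟨-, y', hy', hs'⟩⟩ :=
      exists_mem_sampleSet_of_majority (isBox_half hd0 hd1) hk hk'
    have : y = y' := OrderHom.ext _ _ (funext fun i => Subtype.ext ((hy i).trans (hy' i).symm))
    subst this
    exact hp.eq_of_sample h y (hs.trans hs'.symm)
  -- Fix a second time `x'` by slicing. Whenever the edge of `q` from `x` to `x'` is degenerate,
  -- every lift has the same vertex at `x` as at `x'`. So the vertex of a lift at `x'` names a sheet
  -- that contains it.
  have label {q} (hq : q ∈ U) : ∃ y : Fin 1 →o Set.Ico (0 : ℝ) 1, sample (m := ⦋0⦌) y q = v ∧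
      ∀ k, SSet.toTop.map p k = q →
        k ∈ majority (m := ⦋0⦌) (fun _ => 0) (fun _ => d / 2) (sample (m := ⦋0⦌) y k) := by
    obtain ⟨x', hx', hlt⟩ := exists_slice hd0 hd1 hq
    let y₁ : Fin 1 →o Set.Ico (0 : ℝ) 1 :=
      ⟨fun _ => ⟨x', by linarith [hx'.1], by linarith [hx'.2]⟩, fun _ _ _ => le_rfl⟩
    have hy₁ (y : Fin 2 →o Set.Ico (0 : ℝ) 1) (h : (y 1 : ℝ) = x') :
        y₁ = y.comp (vertexHom ⦋1⦌ 1).toOrderHom :=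
      OrderHom.ext _ _ (funext fun i => Subtype.ext h.symm)
    refine ⟨y₁, ?_, fun k hk => hlt.trans_le' ?_ |>.trans_le ?_⟩
    · have hne : ((fun x : Fin 1 → ℝ => (![x 0, x'] : Fin 2 → ℝ)) ⁻¹'
          sampleSet (m := ⦋1⦌) (![0, d / 2] : Fin 2 → ℝ) (![d / 2, d] : Fin 2 → ℝ) e q).Nonempty := by
        refine Set.nonempty_iff_ne_empty.2 fun h => ?_
        rw [h, measureReal_empty] at hlt
        linarith
      obtain ⟨x, -, y, hy, hs⟩ := hne
      rw [hy₁ y (hy 1), sample_comp, hs, he, ← Functor.map_comp_apply, ← op_comp]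
      exact map_op_congr (fun i => rfl) τ
    · simp
    · refine measureReal_mono ?_ ?_
      · rintro x ⟨hx, y, hy, hs⟩
        refine ⟨fun i => by rw [Subsingleton.elim (α := Fin 1) i 0]; exact hx 0,
          y.comp (vertexHom ⦋1⦌ 0).toOrderHom,
          fun i => by rw [Subsingleton.elim (α := Fin 1) i 0]; exact hy 0, ?_⟩
        rw [hy₁ y (hy 1), sample_comp, sample_comp]
        exact hp.sample_eq_of_degenerate y (hk ▸ hs)
      · refine ne_top_of_le_ne_top ?_ (measure_mono (sampleSet_subset _ _ _ _))
        rw [volume_pi_pi]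
        exact ENNReal.prod_ne_top fun i _ => by simp
  have surj (w) : (V w).SurjOn (SSet.toTop.map p) U := fun q hq => by
    obtain ⟨y, hy, hl⟩ := label hq
    obtain ⟨k, hk, hw⟩ := hp.exists_of_sample y (w.2.trans hy.symm)
    exact ⟨k, by have := hl k hk; rwa [hw] at this, hk⟩
  have exhaustive : SSet.toTop.map p ⁻¹' U ⊆ ⋃ w, V w := fun k hk => by
    obtain ⟨y, hy, hl⟩ := label hk
    exact Set.mem_iUnion.2 ⟨⟨sample (m := ⦋0⦌) y k, by rw [← sample_map]; exact hy⟩, hl k rfl⟩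
  rcases isEmpty_or_nonempty {w : K.obj (op ⦋0⦌) // p.app _ w = v} with hE | hN
  · have hempty : SSet.toTop.map p ⁻¹' U = ∅ :=
      Set.subset_empty_iff.1 (exhaustive.trans (by simp))
    have : IsEmpty (SSet.toTop.map p ⁻¹' {pt τ u}) :=
      Set.isEmpty_coe_sort.2 (Set.subset_empty_iff.1
        ((Set.preimage_mono (Set.singleton_subset_iff.2 hq₀)).trans hempty.subset))
    exact .of_preimage_eq_empty _ (hU.mem_nhds hq₀) hempty
  let _ : TopologicalSpace {w : K.obj (op ⦋0⦌) // p.app _ w = v} := ⊥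
  have : DiscreteTopology {w : K.obj (op ⦋0⦌) // p.app _ w = v} := ⟨rfl⟩
  have hne : Nonempty (SSet.toTop.obj K) := by
    obtain ⟨k, -⟩ := surj (Classical.arbitrary _) hq₀
    exact ⟨k⟩
  refine IsEvenlyCovered.to_isEvenlyCovered_preimage (.of_trivialization
    (t := hU.trivializationDiscrete V U (fun w W hW => ⟨fun h => ?_, fun h => ?_⟩) inj surj
      (fun w w' hww => Set.disjoint_left.2 fun k hk hk' =>
        hww (Subtype.ext (eq_of_majority (isBox_half hd0 hd1) hk hk'))) exhaustive) hq₀)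
  · exact (h.preimage (SSet.toTop.map p).hom.continuous).inter (hV w)
  · convert hp.isOpenMap _ h using 1
    ext q
    constructor
    · intro hq
      obtain ⟨k, hk, rfl⟩ := surj w (hW hq)
      exact ⟨k, ⟨hq, hk⟩, rfl⟩
    · rintro ⟨k, ⟨hk, -⟩, rfl⟩
      exact hk

end Coverings

/-! ### A criterion for weak equivalences -/

section WeakEquiv

variable {X Y : Type u} [TopologicalSpace X] [TopologicalSpace Y]

/-- A map with a deformation retraction, continuity of which is only required after composition
with maps from compact Hausdorff spaces, is a weak equivalence. -/
theorem isWeakEquiv_of_deformation (f : C(X, Y)) (r : Y → X) (F : Y → unitInterval → Y)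
    (hr : ∀ x, r (f x) = x) (F_zero : ∀ y, F y 0 = y) (F_one : ∀ y, F y 1 = f (r y))
    (F_map : ∀ x t, F (f x) t = f x)
    (hcr : ∀ {S : Type} [TopologicalSpace S] [CompactSpace S] [T2Space S] (g : C(S, Y)),
      Continuous fun s => r (g s))
    (hcF : ∀ {S : Type} [TopologicalSpace S] [CompactSpace S] [T2Space S] (g : C(S, Y)),
      Continuous fun z : S × unitInterval => F (g z.1) z.2) : IsWeakEquiv f where
  bijective_zero := by
    constructor
    · intro a b
      refine Quotient.inductionOn₂ a b fun x x' h => ?_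
      obtain ⟨γ⟩ := Quotient.exact h
      exact Quotient.sound ⟨⟨⟨_, hcr γ.toContinuousMap⟩, by simp [hr], by simp [hr]⟩⟩
    · intro b
      refine Quotient.inductionOn b fun y => ⟨Quotient.mk _ (r y), Quotient.sound ⟨Path.symm ?_⟩⟩
      exact ⟨⟨fun t => F y t, (hcF (ContinuousMap.const Unit y)).comp
        (Continuous.prodMk_right ())⟩, F_zero y, F_one y⟩
  bijective_succ n x := by
    constructor
    · intro a b
      refine Quotient.inductionOn₂ a b fun α α' h => ?_
      obtain ⟨H⟩ := Quotient.exact h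
      refine Quotient.sound ⟨⟨⟨⟨_, hcr H.toContinuousMap⟩, fun s => ?_, fun s => ?_⟩,
        fun t s hs => ?_⟩⟩
      · exact (congrArg r (H.map_zero_left s)).trans (hr _)
      · exact (congrArg r (H.map_one_left s)).trans (hr _)
      · exact (congrArg r (H.prop t s hs)).trans (hr _)
    · intro b
      refine Quotient.inductionOn b fun β => ?_
      refine ⟨Quotient.mk _ ⟨⟨_, hcr β.1⟩, fun s hs => (congrArg r (β.2 s hs)).trans (hr x)⟩,
        Quotient.sound (GenLoop.Homotopic.symm ?_)⟩
      refine ⟨⟨⟨⟨_, (hcF β.1).comp continuous_swap⟩, fun s => F_zero _, fun s => F_one _⟩,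
        fun t s hs => ?_⟩⟩
      exact (congrArg (F · t) (β.2 s hs)).trans ((F_map x t).trans (β.2 s hs).symm)

/-- A bijection, the inverse of which is continuous on compact Hausdorff spaces, is a weak
equivalence. -/
theorem isWeakEquiv_of_bijective (f : C(X, Y)) (hf : Function.Bijective f)
    (hc : ∀ {S : Type} [TopologicalSpace S] [CompactSpace S] [T2Space S] (g : S → X),
      Continuous (fun s => f (g s)) → Continuous g) : IsWeakEquiv f := by
  let e := Equiv.ofBijective f hf
  have he : ∀ y, f (e.symm y) = y := e.apply_symm_apply
  refine isWeakEquiv_of_deformation f e.symm (fun y _ => y) e.symm_apply_apply (fun _ => rfl)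
    (fun y => (he y).symm) (fun _ _ => rfl) (fun g => hc _ ?_) (fun g => by fun_prop)
  simp only [he]
  exact g.continuous

end WeakEquiv

/-! ### Maps from compact spaces to coherentifications -/

section Coherent

open scoped CompactCoherentification

/-- Maps from a compact space to a coherentification. -/
theorem continuous_coherent_iff {S Y : Type*} [TopologicalSpace S] [CompactSpace S]
    [TopologicalSpace Y] {g : S → 𝐤 Y} :
    Continuous g ↔ Continuous fun s => (CompactCoherentification.mk Y).symm (g s) := by
  refine ⟨fun h => CompactCoherentification.continuous_mk_symm.comp h, fun h => ?_⟩
  exact (CompactCoherentification.continuous_map_of_continuous h).comp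
    CompactCoherentification.continuous_mk

end Coherent

/-! ### Segal spaces from strict composition and unique path lifting -/

section StrictSegal

open scoped CompactCoherentification

variable {G : Type u} [Group G]

/-- The operator `X_n → X_m` of a simplicial `G`-space which belongs to `f : [m] → [n]`. -/
def restr (X : SimplicialGSpace G) {m n : SimplexCategory} (f : m ⟶ n) (x : (X.obj (op n)).V) :
    (X.obj (op m)).V := GTop.map (X.map f.op) x

variable {X : SimplicialGSpace G}

theorem continuous_restr {m n : SimplexCategory} (f : m ⟶ n) : Continuous (restr X f) :=
  (GTop.map (X.map f.op)).continuous

theorem restr_smul {m n : SimplexCategory} (f : m ⟶ n) (g : G) (x : (X.obj (op n)).V) :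
    restr X f (g • x) = g • restr X f x := GTop.map_smul _ g x

theorem restr_comp {l m n : SimplexCategory} (e : l ⟶ m) (f : m ⟶ n) (x : (X.obj (op n)).V) :
    restr X (e ≫ f) x = restr X e (restr X f x) :=
  congrArg (fun φ => GTop.map φ x) (X.map_comp f.op e.op)

theorem restr_id {n : SimplexCategory} (x : (X.obj (op n)).V) : restr X (𝟙 n) x = x :=
  congrArg (fun φ => GTop.map φ x) (X.map_id (op n))

theorem vertexHom_spine_zero {n : ℕ} (i : Fin n) :
    SimplexCategory.δ 1 ≫ SimplexCategory.mkOfSucc i = vertexHom ⦋n⦌ i.castSucc :=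
  simplexHom_ext fun k => by rw [Subsingleton.elim (α := Fin 1) k 0]; rfl

theorem vertexHom_spine_one {n : ℕ} (i : Fin n) :
    SimplexCategory.δ 0 ≫ SimplexCategory.mkOfSucc i = vertexHom ⦋n⦌ i.succ :=
  simplexHom_ext fun k => by rw [Subsingleton.elim (α := Fin 1) k 0]; rfl

variable (X) in
/-- Simplicial `G`-spaces, the points of which in positive degrees are the chains of points of
degree one, such that paths in degree one are determined by the initial point and the paths of
the two vertices, which may be prescribed. -/
structure IsStrictSegal : Prop where
  spine_injective : ∀ (n : ℕ) (x y : (X.obj (op ⦋n + 1⦌)).V),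
    (∀ i, restr X (SimplexCategory.mkOfSucc i) x = restr X (SimplexCategory.mkOfSucc i) y) → x = y
  spine_surjective : ∀ (n : ℕ) (x : Fin (n + 1) → (X.obj (op ⦋1⦌)).V),
    (∀ i j : Fin (n + 1), (i : ℕ) + 1 = j →
      restr X (SimplexCategory.δ 0) (x i) = restr X (SimplexCategory.δ 1) (x j)) →
    ∃ y, ∀ i, restr X (SimplexCategory.mkOfSucc i) y = x i
  continuous : ∀ (n : ℕ) {S : Type} [TopologicalSpace S] [CompactSpace S]
    (h : S → (X.obj (op ⦋n + 1⦌)).V),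
    (∀ i, Continuous fun s => restr X (SimplexCategory.mkOfSucc i) (h s)) → Continuous h
  edge_lift : ∀ {S : Type} [TopologicalSpace S] [CompactSpace S] (a : S → (X.obj (op ⦋1⦌)).V)
    (h₀ h₁ : S × unitInterval → (X.obj (op ⦋0⦌)).V), Continuous a → Continuous h₀ →
    Continuous h₁ → (∀ s, h₀ (s, 0) = restr X (SimplexCategory.δ 1) (a s)) →
    (∀ s, h₁ (s, 0) = restr X (SimplexCategory.δ 0) (a s)) →
    ∃ k : S × unitInterval → (X.obj (op ⦋1⦌)).V, Continuous k ∧ (∀ s, k (s, 0) = a s) ∧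
      (∀ z, restr X (SimplexCategory.δ 1) (k z) = h₀ z) ∧
      ∀ z, restr X (SimplexCategory.δ 0) (k z) = h₁ z
  edge_unique : ∀ k k' : unitInterval → (X.obj (op ⦋1⦌)).V, Continuous k → Continuous k' →
    k 0 = k' 0 →
    (∀ t, restr X (SimplexCategory.δ 1) (k t) = restr X (SimplexCategory.δ 1) (k' t)) →
    (∀ t, restr X (SimplexCategory.δ 0) (k t) = restr X (SimplexCategory.δ 0) (k' t)) → k = k'

namespace IsStrictSegal

variable (hX : IsStrictSegal X)
include hX

/-- Paths are determined by the initial point and the paths of the vertices. -/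
theorem path_unique {n : ℕ} {k k' : unitInterval → (X.obj (op ⦋n⦌)).V} (hk : Continuous k)
    (hk' : Continuous k') (h0 : k 0 = k' 0)
    (hv : ∀ i t, restr X (vertexHom ⦋n⦌ i) (k t) = restr X (vertexHom ⦋n⦌ i) (k' t)) (t) :
    k t = k' t := by
  cases n with
  | zero =>
    have e : vertexHom ⦋0⦌ 0 = 𝟙 _ := simplexHom_ext fun i => Subsingleton.elim (α := Fin 1) _ _
    simpa only [e, restr_id] using hv 0 t
  | succ n =>
    refine hX.spine_injective n _ _ fun i => ?_
    refine congrFun (hX.edge_unique (fun t => restr X (SimplexCategory.mkOfSucc i) (k t))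
      (fun t => restr X (SimplexCategory.mkOfSucc i) (k' t)) ((continuous_restr _).comp hk)
      ((continuous_restr _).comp hk') (by rw [h0]) (fun t => ?_) fun t => ?_) t
    · simp only [← restr_comp, vertexHom_spine_zero, hv]
    · simp only [← restr_comp, vertexHom_spine_one, hv]

/-- Homotopies lift along prescribed homotopies of the vertices. -/
theorem homotopy_lift {n : ℕ} {S : Type} [TopologicalSpace S] [CompactSpace S]
    (a : S → (X.obj (op ⦋n + 1⦌)).V) (h : Fin (n + 2) → S × unitInterval → (X.obj (op ⦋0⦌)).V)
    (ha : Continuous a) (hh : ∀ i, Continuous (h i))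
    (hah : ∀ i s, h i (s, 0) = restr X (vertexHom ⦋n + 1⦌ i) (a s)) :
    ∃ k : S × unitInterval → (X.obj (op ⦋n + 1⦌)).V, Continuous k ∧ (∀ s, k (s, 0) = a s) ∧
      ∀ i z, restr X (vertexHom ⦋n + 1⦌ i) (k z) = h i z := by
  have H : ∀ i : Fin (n + 1), _ := fun i => hX.edge_lift
    (fun s => restr X (SimplexCategory.mkOfSucc i) (a s)) (h i.castSucc) (h i.succ)
    ((continuous_restr _).comp ha) (hh _) (hh _)
    (fun s => by rw [hah, ← restr_comp, vertexHom_spine_zero])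
    (fun s => by rw [hah, ← restr_comp, vertexHom_spine_one])
  choose e he he0 hes het using H
  have H : ∀ z, _ := fun z => hX.spine_surjective n (fun i => e i z) fun i j hij => by
    rw [hes, het]
    exact congrArg (h · z) (Fin.ext hij)
  choose k hk using H
  refine ⟨k, hX.continuous n k fun i => by simpa only [hk] using he i, fun s => ?_, fun i z => ?_⟩
  · exact hX.spine_injective n _ _ fun i => by rw [hk, he0]
  · induction i using Fin.lastCases with
    | last => rw [← Fin.succ_last, ← vertexHom_spine_one, restr_comp, hk, het]
    | cast i => rw [← vertexHom_spine_zero, restr_comp, hk, hes]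

variable [IsCGHaus X]

/-- In positive degree the boundary contains all vertices. Lift along the paths of the vertices; the
remaining conditions are equalities of paths with the same start and the same vertices. -/
theorem isGFibration_matchingMap (n : ℕ) : IsGFibration (matchingMap X n) := by
  intro H d a h hah
  cases n with
  | zero =>
    -- The boundary of Δ[0] is empty, so the matching object is a point and the constant homotopy
    -- lifts.
    refine ⟨a.comp ContinuousMap.fst, fun _ => rfl, fun z => Subtype.ext (Subtype.ext ?_)⟩
    funext m s
    exact absurd s.2 (by simp [SSet.boundary_zero])
  | succ n =>
    let b (z) : WeightedLimit (SSet.boundary.{u} (n + 1) : SSet.{u}) X := (h z).1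
    have hbc : Continuous b := by
      have h1 : Continuous fun z => ((h z).1 : (matchingObject X (n + 1)).V) :=
        continuous_subtype_val.comp h.continuous
      exact continuous_coherent_iff.1 h1
    have hb : ∀ {m} s, Continuous fun z => (b z).1 m s := fun {m} s =>
      (continuous_apply s).comp ((continuous_apply m).comp (continuous_subtype_val.comp hbc))
    have hbH : ∀ g ∈ H, ∀ z m s, g • (b z).1 m s = (b z).1 m s := fun g hg z m s =>
      congrFun (congrFun (congrArg Subtype.val ((h z).2 g hg)) m) s
    have hb0 : ∀ x m (s : (SSet.boundary.{u} (n + 1) : SSet.{u}).obj m),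
        (b (x, 0)).1 m s = restr X (SSet.stdSimplex.objEquiv s.1) (a x).1 := fun x m s =>
      congrFun (congrFun (congrArg Subtype.val (congrArg Subtype.val (hah x))) m) s
    let v (i : Fin (n + 2)) : (SSet.boundary.{u} (n + 1) : SSet.{u}).obj (op ⦋0⦌) :=
      ⟨SSet.stdSimplex.objEquiv.symm (vertexHom ⦋n + 1⦌ i), by
        rw [SSet.boundary_obj_eq_univ _ _ (by omega)]; trivial⟩
    obtain ⟨k, hk, hk0, hkv⟩ := hX.homotopy_lift (fun x => (a x).1)
      (fun i z => (b z).1 _ (v i)) (continuous_subtype_val.comp a.continuous) (fun i => hb _)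
      (fun i s => by rw [hb0]; rfl)
    -- The translate by `g` is a second lift with the same start and the same vertex paths, so it
    -- coincides with `k`.
    have hkH : ∀ z, ∀ g ∈ H, g • k z = k z := fun z g hg => by
      refine hX.path_unique (k := fun t => g • k (z.1, t)) (k' := fun t => k (z.1, t))
        ((continuous_const_smul g).comp (hk.comp (by fun_prop))) (hk.comp (by fun_prop)) ?_ ?_ z.2
      · rw [hk0]; exact (a z.1).2 g hg
      · intro i t
        rw [restr_smul, hkv, hbH g hg]
    refine ⟨⟨fun z => ⟨k z, hkH z⟩, hk.subtype_mk _⟩, fun x => Subtype.ext (hk0 x), fun z => ?_⟩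
    refine Subtype.ext (Subtype.ext (funext fun m => funext fun s => ?_))
    change restr X (SSet.stdSimplex.objEquiv s.1) (k z) = (b z).1 m s
    refine hX.path_unique (n := m.unop.len)
      (k := fun t => restr X (SSet.stdSimplex.objEquiv s.1) (k (z.1, t)))
      (k' := fun t => (b (z.1, t)).1 m s)
      ((continuous_restr _).comp (hk.comp (by fun_prop))) ((hb s).comp (by fun_prop)) ?_ ?_ z.2
    · rw [hk0, hb0]
    · intro i t
      have e : vertexHom m.unop i ≫ SSet.stdSimplex.objEquiv s.1 =
          vertexHom ⦋n + 1⦌ (SSet.stdSimplex.objEquiv s.1 i) :=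
        simplexHom_ext fun k => rfl
      refine (restr_comp _ _ _).symm.trans ((congrArg (restr X · _) e).trans ?_)
      rw [hkv]
      refine Eq.trans ?_ ((b (z.1, t)).2 m (op ⦋0⦌) (vertexHom m.unop i).op s)
      refine congrArg ((b (z.1, t)).1 (op ⦋0⦌)) (Subtype.ext ?_)
      exact SSet.stdSimplex.objEquiv.injective e.symm

/-- The Segal map is bijective. The chain of a point is fixed only if the point is, by injectivity,
so bijectivity passes to fixed points. -/
theorem isGEquivalence_segalMap (n : ℕ) : IsGEquivalence (segalMap X (n + 1)) := by
  intro H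
  refine isWeakEquiv_of_bijective _ ⟨fun x y hxy => ?_, fun y => ?_⟩ fun g hg => ?_
  · refine Subtype.ext (hX.spine_injective n _ _ fun i => ?_)
    exact congrFun (congrArg Subtype.val (congrArg Subtype.val hxy)) i
  · let b : FibreProduct X (n + 1) := y.1
    obtain ⟨x, hx⟩ := hX.spine_surjective n b.1 b.2
    refine ⟨⟨x, fun g hg => hX.spine_injective n _ _ fun i => ?_⟩,
      Subtype.ext (Subtype.ext (funext hx))⟩
    rw [restr_smul, hx]
    exact congrFun (congrArg Subtype.val (y.2 g hg)) i
  · refine Continuous.subtype_mk (hX.continuous n _ fun i => ?_) _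
    have h1 : Continuous fun s => ((GTop.fixedMap H (segalMap X (n + 1)) (g s)).1 :
        (segalObject X (n + 1)).V) := continuous_subtype_val.comp hg
    have h2 := continuous_coherent_iff (Y := FibreProduct X (n + 1)).1 h1
    exact (continuous_apply i).comp (continuous_subtype_val.comp h2)

theorem isSegalGSpace : IsSegalGSpace X where
  reedyFibrant := hX.isGFibration_matchingMap
  segal n hn := by
    obtain ⟨n, rfl⟩ := Nat.exists_eq_add_of_le' (by omega : 1 ≤ n)
    exact hX.isGEquivalence_segalMap n

end IsStrictSegal

end StrictSegal

/-! ### Simplices of the classifying diagram as diagrams in categories of families -/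

section Family

universe w

variable {J : Type w} [Category.{0} J] {J' : Type w} [Category.{0} J'] {P Q : Type}
  [Category.{0} P] [Category.{0} Q] {C : Type u} [Category.{u} C]

variable (P C) in
/-- The category of functors from `P` to the maximal subgroupoid of `C`, with all natural
transformations between the induced functors to `C` as morphisms. -/
abbrev Family : Type u :=
  InducedCategory (P ⥤ C) fun F : P ⥤ Core C => F ⋙ Core.inclusion C

/-- The underlying functor of a family. -/
abbrev Family.functor (F : Family P C) : P ⥤ Core C := F

/-- Restriction of families. -/
def Family.restrict (f : Q ⥤ P) : Family P C ⥤ Family Q C where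
  obj F := (f ⋙ F : Q ⥤ Core C)
  map α := ⟨Functor.whiskerLeft f α.hom⟩

/-- Families of `J`-diagrams of `C` are `J`-diagrams of families. -/
def transpose (σ : P ⥤ Core (J ⥤ C)) : J ⥤ Family P C where
  obj j := (σ ⋙ ((evaluation J C).obj j).core : P ⥤ Core C)
  map a := ⟨{ app := fun p => (σ.obj p).of.map a
              naturality := fun _ _ f => ((σ.map f).iso.hom.naturality a).symm }⟩
  map_id j := InducedCategory.hom_ext (NatTrans.ext (funext fun p => (σ.obj p).of.map_id j))
  map_comp a b := InducedCategory.hom_ext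
    (NatTrans.ext (funext fun p => (σ.obj p).of.map_comp a b))

/-- The inverse of `transpose`. -/
def untranspose (τ : J ⥤ Family P C) : P ⥤ Core (J ⥤ C) where
  obj p := ⟨{ obj := fun j => ((Family.functor (τ.obj j)).obj p).of
              map := fun a => (τ.map a).hom.app p
              map_id := fun j => by rw [τ.map_id]; rfl
              map_comp := fun a b => by rw [τ.map_comp]; rfl }⟩
  map f := ⟨NatIso.ofComponents (fun j => ((Family.functor (τ.obj j)).map f).iso)
    fun a => ((τ.map a).hom.naturality f).symm⟩
  map_id p := by
    refine Core.hom_ext (NatTrans.ext (funext fun j => ?_))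
    exact congrArg (fun e => CoreHom.iso e |>.hom)
      ((Family.functor (τ.obj j)).map_id p)
  map_comp f g := by
    refine Core.hom_ext (NatTrans.ext (funext fun j => ?_))
    exact congrArg (fun e => CoreHom.iso e |>.hom)
      ((Family.functor (τ.obj j)).map_comp f g)

theorem untranspose_transpose (σ : P ⥤ Core (J ⥤ C)) : untranspose (transpose σ) = σ := rfl

theorem transpose_injective :
    Function.Injective (transpose : (P ⥤ Core (J ⥤ C)) → (J ⥤ Family P C)) := fun σ σ' h => by
  rw [← untranspose_transpose σ, h, untranspose_transpose]

/-- The isomorphism from the value of a family at `i` to the value at `p`. -/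
def connect {n : ℕ} (F : Fin (n + 1) ⥤ Core C) (i p : Fin (n + 1)) :
    (F.obj i).of ≅ (F.obj p).of :=
  if h : i ≤ p then (F.map (homOfLE h)).iso else (F.map (homOfLE (le_of_not_ge h))).iso.symm

theorem connect_map {n : ℕ} (F : Fin (n + 1) ⥤ Core C) (i : Fin (n + 1)) {p q : Fin (n + 1)}
    (f : p ⟶ q) : connect F i p ≪≫ (F.map f).iso = connect F i q := by
  have hf : p ≤ q := leOfHom f
  have hc : ∀ {a b c : Fin (n + 1)} (f : a ⟶ b) (g : b ⟶ c) (h : a ⟶ c),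
      (F.map h).iso = (F.map f).iso ≪≫ (F.map g).iso := fun f g h => by
    rw [Subsingleton.elim h (f ≫ g), F.map_comp]; rfl
  unfold connect
  split_ifs with h1 h2 h2
  · exact (hc _ _ _).symm
  · exact absurd (h1.trans hf) h2
  · rw [hc (homOfLE (le_of_not_ge h1)) (homOfLE h2) f, Iso.symm_self_id_assoc]
  · rw [hc f (homOfLE (le_of_not_ge h2)) (homOfLE (le_of_not_ge h1)), Iso.trans_symm,
      Iso.trans_assoc, Iso.symm_self_id, Iso.trans_refl]

theorem connect_self {n : ℕ} (F : Fin (n + 1) ⥤ Core C) (i : Fin (n + 1)) :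
    connect F i i = Iso.refl _ := by
  have h : F.map (homOfLE (le_refl i)) = 𝟙 _ := F.map_id i
  rw [connect, dif_pos le_rfl, h]
  rfl

theorem connect_naturality {n : ℕ} {F G : Fin (n + 1) ⥤ Core C}
    (α : F ⋙ Core.inclusion C ⟶ G ⋙ Core.inclusion C) (i p : Fin (n + 1)) :
    (connect F i p).hom ≫ α.app p = α.app i ≫ (connect G i p).hom := by
  unfold connect
  split_ifs with h
  · exact α.naturality (homOfLE h)
  · have := α.naturality (homOfLE (le_of_not_ge h))
    refine (Iso.inv_comp_eq (F.map (homOfLE (le_of_not_ge h))).iso).2 ?_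
    refine Eq.trans ?_ (Category.assoc _ _ _)
    exact ((Iso.comp_inv_eq (G.map (homOfLE (le_of_not_ge h))).iso).2 this).symm

/-- A morphism of families indexed by an ordinal is determined by an arbitrary component. -/
theorem restrict_vertex_bijective {n : SimplexCategory} (i : Fin (n.len + 1))
    (F G : Family (Fin (n.len + 1)) C) : Function.Bijective
      ((Family.restrict (C := C) (SimplexCategory.toCat.map (vertexHom n i)).toFunctor).map :
        (F ⟶ G) → _) := by
  constructor
  · intro α β h
    refine InducedCategory.hom_ext (NatTrans.ext (funext fun p => ?_))
    have h0 : α.hom.app i = β.hom.app i :=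
      congrArg (fun γ => NatTrans.app (InducedCategory.Hom.hom γ) (0 : Fin 1)) h
    refine (Iso.cancel_iso_hom_left (connect F i p) _ _).1 ?_
    exact (connect_naturality α.hom i p).trans
      ((congrArg (· ≫ _) h0).trans (connect_naturality β.hom i p).symm)
  · intro w
    refine ⟨⟨{ app := fun p => (connect F i p).inv ≫ w.hom.app (0 : Fin 1) ≫ (connect G i p).hom
               naturality := fun p q f => ?_ }⟩, InducedCategory.hom_ext (NatTrans.ext ?_)⟩
    · have hF : (F.functor.map f).iso.hom ≫ (connect F i q).inv = (connect F i p).inv := by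
        rw [← connect_map F i f]
        exact Iso.hom_inv_id_assoc _ _
      have hG : (connect G i p).hom ≫ (G.functor.map f).iso.hom = (connect G i q).hom :=
        congrArg Iso.hom (connect_map G i f)
      refine (Category.assoc _ _ _).symm.trans ((congrArg (· ≫ _) hF).trans ?_)
      refine Eq.trans ?_ (Category.assoc _ _ _).symm
      refine congrArg (_ ≫ ·) (Eq.trans ?_ (Category.assoc _ _ _).symm)
      exact congrArg (_ ≫ ·) hG.symm
    · funext k
      obtain rfl : k = (0 : Fin 1) := Subsingleton.elim (α := Fin 1) _ _
      change (connect F i i).inv ≫ w.hom.app (0 : Fin 1) ≫ (connect G i i).hom = _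
      rw [connect_self, connect_self]
      exact (Category.id_comp _).trans (Category.comp_id _)

end Family

/-! ### Edges and spines in nerves -/

section Nerve

/-- Edges of nerves lift uniquely along fully faithful functors. -/
theorem existsUnique_edge {D D' : Type u} [Category.{u} D] [Category.{u} D'] (F : D ⥤ D')
    (hF : ∀ x y, Function.Bijective (F.map : (x ⟶ y) → _)) (x y : ComposableArrows D 0)
    (e : ComposableArrows D' 1)
    (h₀ : (nerve D').δ 1 e = (nerveMap F).app (op ⦋0⦌) x)
    (h₁ : (nerve D').δ 0 e = (nerveMap F).app (op ⦋0⦌) y) :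
    ∃! a : ComposableArrows D 1, (nerveMap F).app (op ⦋1⦌) a = e ∧ (nerve D).δ 1 a = x ∧
      (nerve D).δ 0 a = y := by
  obtain ⟨x, rfl⟩ := nerveEquiv.symm.surjective x
  obtain ⟨y, rfl⟩ := nerveEquiv.symm.surjective y
  have key : ∀ e : (nerve D').Edge ((nerveMap F).app (op ⦋0⦌) (nerveEquiv.symm x))
      ((nerveMap F).app (op ⦋0⦌) (nerveEquiv.symm y)), ∃ f : x ⟶ y,
      (nerve.edgeMk f).map (nerveMap F) = e := fun e => by
    obtain ⟨f, hf⟩ := (hF x y).2 (nerve.homEquiv e)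
    exact ⟨f, nerve.homEquiv.injective ((nerve.homEquiv_edgeMk_map_nerveMap f F).trans hf)⟩
  obtain ⟨f, hf⟩ := key (.mk e h₀ h₁)
  refine ⟨(nerve.edgeMk f).edge, ⟨congrArg SSet.Edge.edge hf, SSet.Edge.src_eq _,
    SSet.Edge.tgt_eq _⟩, fun a ⟨ha, hax, hay⟩ => ?_⟩
  obtain ⟨g, hg⟩ := nerve.edgeMk_surjective (SSet.Edge.mk a hax hay)
  have hga : (nerve.edgeMk g).edge = a := congrArg SSet.Edge.edge hg
  rw [← hga]
  refine congrArg (fun f => (nerve.edgeMk f).edge) ((hF x y).1 ?_)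
  rw [← nerve.homEquiv_edgeMk_map_nerveMap f F, ← nerve.homEquiv_edgeMk_map_nerveMap g F]
  refine congrArg nerve.homEquiv (SSet.Edge.ext ?_)
  rw [hf, hg]
  exact ha

/-- Matching edges of a nerve are the spine of a simplex. -/
theorem exists_of_spine {Y : SSet.{u}} (hY : Y.StrictSegal) {n : ℕ} (e : Fin (n + 1) → Y _⦋1⦌)
    (h : ∀ i j : Fin (n + 1), (i : ℕ) + 1 = j → Y.δ 0 (e i) = Y.δ 1 (e j)) :
    ∃ y : Y _⦋n + 1⦌, ∀ i, Y.map (SimplexCategory.mkOfSucc i).op y = e i := by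
  obtain ⟨v, hv, hv'⟩ : ∃ v : Fin (n + 2) → Y _⦋0⦌, (∀ i, v (Fin.castSucc i) = Y.δ 1 (e i)) ∧
      v (Fin.last _) = Y.δ 0 (e (Fin.last n)) :=
    ⟨Fin.lastCases (Y.δ 0 (e (Fin.last n))) fun i => Y.δ 1 (e i),
      fun i => Fin.lastCases_castSucc .., Fin.lastCases_last⟩
  let p : Y.Path (n + 1) :=
    { vertex := v
      arrow := e
      arrow_src := fun i => (hv i).symm
      arrow_tgt := fun i => by
        induction i using Fin.lastCases with
        | last => exact hv'.symm
        | cast i => exact (h i.castSucc i.succ rfl).trans (hv i.succ).symm }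
  exact ⟨hY.spineToSimplex p, fun i => hY.spineToSimplex_arrow i p⟩

end Nerve

/-! ### Products of realizations -/

section Product

open CartesianMonoidalCategory MonoidalCategory

variable {K L : SSet.{u}}

/-- The two projections of a product of simplicial sets. -/
def prodProj (K L : SSet.{u}) (k : Bool) : K ⊗ L ⟶ cond k K L :=
  match k with
  | true => fst K L
  | false => snd K L

theorem jointlyInjective_prodProj (K L : SSet.{u}) : JointlyInjective (prodProj K L) :=
  fun _ _ _ h => Prod.ext (h true) (h false)

theorem prod_ext {x y : SSet.toTop.obj (K ⊗ L)}
    (h₁ : SSet.toTop.map (fst K L) x = SSet.toTop.map (fst K L) y)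
    (h₂ : SSet.toTop.map (snd K L) x = SSet.toTop.map (snd K L) y) : x = y :=
  (jointlyInjective_prodProj K L).eq fun k => match k with
    | true => h₁
    | false => h₂

/-- Pairs of continuous maps on a compact space are maps to the realization of the product. -/
theorem exists_prod_lift {S : Type*} [TopologicalSpace S] [CompactSpace S]
    {f : S → SSet.toTop.obj K} {g : S → SSet.toTop.obj L} (hf : Continuous f)
    (hg : Continuous g) : ∃ h : S → SSet.toTop.obj (K ⊗ L), Continuous h ∧
      (∀ s, SSet.toTop.map (fst K L) (h s) = f s) ∧
      ∀ s, SSet.toTop.map (snd K L) (h s) = g s := by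
  have H : ∀ s, ∃ z : SSet.toTop.obj (K ⊗ L), SSet.toTop.map (fst K L) z = f s ∧
      SSet.toTop.map (snd K L) z = g s := fun s => by
    obtain ⟨p, u, σ, τ, -, h1, h2⟩ := exists_common_pt₂ (f s) (g s)
    exact ⟨pt (K := K ⊗ L) (n := p) (σ, τ) u, (toTop_map_pt _ _ _).trans h1,
      (toTop_map_pt _ _ _).trans h2⟩
  choose h h1 h2 using H
  refine ⟨h, (jointlyInjective_prodProj K L).continuous fun k => ?_, h1, h2⟩
  cases k
  · exact hg.congr fun s => (h2 s).symm
  · exact hf.congr fun s => (h1 s).symm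

end Product

/-! ### The classifying diagram is strictly Segal -/

section Classifying

open CartesianMonoidalCategory MonoidalCategory

variable {D : Type u} [Category.{u} D]

variable (D) in
/-- The nerve of the maximal subgroupoid of the category of functors from `[n]` to `D`. -/
abbrev diagNerve (n : SimplexCategory) : SSet.{u} := nerve (Core (ComposableArrows D n.len))

/-- Precomposition with a map `[m] → [n]`. -/
def diagMap {m n : SimplexCategory} (f : m ⟶ n) : diagNerve D n ⟶ diagNerve D m :=
  nerveMap ((Functor.whiskeringLeft _ _ D).obj (SimplexCategory.toCat.map f).toFunctor).core

/-- After transposition this is the fact that a simplex of a nerve is determined by its spine. -/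
theorem jointlyInjective_spine (n : ℕ) :
    JointlyInjective fun i : Fin (n + 1) => diagMap (D := D) (SimplexCategory.mkOfSucc i) :=
  fun _ _ _ h => transpose_injective <| (Nerve.strictSegal _).spineInjective <|
    SSet.Path.ext' fun i => congrArg transpose (h i)

theorem exists_simplex_of_spine {n : ℕ} {p : SimplexCategory}
    (σ : Fin (n + 1) → (diagNerve D ⦋1⦌).obj (op p))
    (h : ∀ i j : Fin (n + 1), (i : ℕ) + 1 = j →
      (diagMap (SimplexCategory.δ 0)).app (op p) (σ i) =
        (diagMap (SimplexCategory.δ 1)).app (op p) (σ j)) :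
    ∃ τ : (diagNerve D ⦋n + 1⦌).obj (op p),
      ∀ i, (diagMap (SimplexCategory.mkOfSucc i)).app (op p) τ = σ i := by
  obtain ⟨y, hy⟩ := exists_of_spine (Nerve.strictSegal (Family (Fin (p.len + 1)) D))
    (fun i => transpose (σ i)) fun i j hij => congrArg transpose (h i j hij)
  exact ⟨untranspose y, fun i => transpose_injective (hy i)⟩

variable (D) in
/-- The map which sends a family of arrows to the families of the sources and targets. -/
def endpoints : diagNerve D ⦋1⦌ ⟶ diagNerve D ⦋0⦌ ⊗ diagNerve D ⦋0⦌ :=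
  lift (diagMap (SimplexCategory.δ 1)) (diagMap (SimplexCategory.δ 0))

/-- Transposed, a lift of `τ` is a morphism of families with prescribed source and target, and
restriction of families to the vertex `i` is fully faithful. -/
theorem isSimplicialCovering_endpoints : IsSimplicialCovering (endpoints D) := by
  intro n i τ w h
  have h₁ : (diagMap (SimplexCategory.δ 1)).app (op ⦋0⦌) w =
    (diagNerve D ⦋0⦌).map (vertexHom n i).op τ.1 := congrArg Prod.fst h
  have h₂ : (diagMap (SimplexCategory.δ 0)).app (op ⦋0⦌) w =
    (diagNerve D ⦋0⦌).map (vertexHom n i).op τ.2 := congrArg Prod.snd h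
  obtain ⟨a, ⟨ha, ha₁, ha₂⟩, hu⟩ := existsUnique_edge
    (Family.restrict (C := D) (SimplexCategory.toCat.map (vertexHom n i)).toFunctor)
    (restrict_vertex_bijective i) (transpose τ.1) (transpose τ.2) (transpose w)
    (congrArg transpose h₁) (congrArg transpose h₂)
  refine ⟨untranspose a, ⟨Prod.ext (transpose_injective ha₁) (transpose_injective ha₂),
    transpose_injective ha⟩, fun κ hκ => transpose_injective (hu _ ⟨?_, ?_, ?_⟩)⟩
  · exact congrArg transpose hκ.2
  · exact congrArg transpose (congrArg Prod.fst hκ.1)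
  · exact congrArg transpose (congrArg Prod.snd hκ.1)

theorem toTop_map_comp {K L M : SSet.{u}} (f : K ⟶ L) (g : L ⟶ M) (x : SSet.toTop.obj K) :
    SSet.toTop.map (f ≫ g) x = SSet.toTop.map g (SSet.toTop.map f x) := by
  rw [Functor.map_comp]; rfl

theorem fst_endpoints (x : SSet.toTop.obj (diagNerve D ⦋1⦌)) :
    SSet.toTop.map (fst _ _) (SSet.toTop.map (endpoints D) x) =
      SSet.toTop.map (diagMap (SimplexCategory.δ 1)) x := by
  rw [← toTop_map_comp, endpoints, lift_fst]

theorem snd_endpoints (x : SSet.toTop.obj (diagNerve D ⦋1⦌)) :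
    SSet.toTop.map (snd _ _) (SSet.toTop.map (endpoints D) x) =
      SSet.toTop.map (diagMap (SimplexCategory.δ 0)) x := by
  rw [← toTop_map_comp, endpoints, lift_snd]

variable {G : Type u} [Group G] (C : Action Cat.{u, u} G)

instance : IsCGHaus (classifyingDiagram C) where
  t2 m := inferInstanceAs (T2Space (SSet.toTop.obj (diagNerve C.V m.unop)))
  compactlyGenerated m :=
    inferInstanceAs (CompactlyCoherentSpace (SSet.toTop.obj (diagNerve C.V m.unop)))

/-- Spines are handled on simplices over a common interior point; the two conditions on edges are
homotopy lifting and unique lifting for the covering `endpoints`. -/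
theorem isStrictSegal_classifyingDiagram : IsStrictSegal (classifyingDiagram C) where
  spine_injective n x y h := (jointlyInjective_spine (D := C.V) n).eq h
  spine_surjective n x h := by
    -- With one interior `u` for all edges, the matching of endpoints holds already for the
    -- representing simplices.
    obtain ⟨p, u, σ, hu, hσ⟩ := exists_common_pt (K := fun _ => diagNerve C.V ⦋1⦌) x
    obtain ⟨τ, hτ⟩ := exists_simplex_of_spine σ fun i j hij => pt_injective hu <| by
      have := h i j hij
      rw [← hσ, ← hσ] at this
      exact (toTop_map_pt _ _ _).symm.trans (this.trans (toTop_map_pt _ _ _))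
    refine ⟨pt τ u, fun i => ?_⟩
    rw [← hσ, ← hτ]
    exact toTop_map_pt _ _ _
  continuous n {S} _ _ h hc := (jointlyInjective_spine (D := C.V) n).continuous hc
  edge_lift {S} _ _ a h₀ h₁ ha hh₀ hh₁ e₀ e₁ := by
    obtain ⟨H, hH, hH₁, hH₂⟩ := exists_prod_lift (K := diagNerve C.V ⦋0⦌)
      (L := diagNerve C.V ⦋0⦌) hh₀ hh₁
    have hc := (isSimplicialCovering_endpoints (D := C.V)).isCoveringMap
    have h0 : ∀ s, H (s, 0) = SSet.toTop.map (endpoints C.V) (a s) := fun s =>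
      prod_ext ((hH₁ _).trans ((e₀ s).trans (fst_endpoints _).symm))
        ((hH₂ _).trans ((e₁ s).trans (snd_endpoints _).symm))
    let F := hc.liftHomotopy (A := S) ⟨fun z => H (z.2, z.1), by fun_prop⟩ ⟨a, ha⟩ h0
    have hF : ∀ z : S × unitInterval, SSet.toTop.map (endpoints C.V) (F (z.2, z.1)) = H z :=
      fun z => congrFun (hc.liftHomotopy_lifts (A := S) ⟨fun z => H (z.2, z.1), by fun_prop⟩
        ⟨a, ha⟩ h0) (z.2, z.1)
    refine ⟨fun z => F (z.2, z.1), F.continuous.comp continuous_swap,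
      fun s => hc.liftHomotopy_zero .., fun z => ?_, fun z => ?_⟩
    · exact (fst_endpoints _).symm.trans ((congrArg _ (hF z)).trans (hH₁ z))
    · exact (snd_endpoints _).symm.trans ((congrArg _ (hF z)).trans (hH₂ z))
  edge_unique k k' hk hk' h0 h₁ h₂ := by
    have hc := (isSimplicialCovering_endpoints (D := C.V)).isCoveringMap
    refine hc.eq_of_comp_eq hk hk' (funext fun t => prod_ext ?_ ?_) 0 h0
    · exact (fst_endpoints _).trans ((h₁ t).trans (fst_endpoints _).symm)
    · exact (snd_endpoints _).trans ((h₂ t).trans (snd_endpoints _).symm)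

end Classifying

/-! ### Diagrams indexed by the free-living isomorphism -/

section WalkingIso

/-- The chain of arrows of the free-living isomorphism with given objects. -/
def isoChain {n : ℕ} (v : Fin (n + 1) → WalkingIso.{u}) : ComposableArrows WalkingIso.{u} n where
  obj := v
  map _ := ()

/-- The three-term chain which starts and ends with `i`. -/
abbrev roundTrip (i j : WalkingIso.{u}) : ComposableArrows WalkingIso.{u} 2 := isoChain ![i, j, i]

/-- The degenerate long edges of `S` and `S'` say that the two short edges compose to identities in
both orders. -/
theorem exists_walkingIso_functor {E : Type u} [Category.{u} E] (S S' : (nerve E) _⦋2⦌)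
    (h₂ : (nerve E).δ 2 S = (nerve E).δ 0 S') (h₀ : (nerve E).δ 0 S = (nerve E).δ 2 S')
    (h₁ : (nerve E).δ 1 S = (nerve E).σ 0 ((nerve E).δ 1 ((nerve E).δ 2 S)))
    (h₁' : (nerve E).δ 1 S' = (nerve E).σ 0 ((nerve E).δ 1 ((nerve E).δ 2 S'))) :
    ∃ Φ : WalkingIso.{u} ⥤ E, roundTrip .zero .one ⋙ Φ = S ∧ roundTrip .one .zero ⋙ Φ = S' := by
  let x : (nerve E) _⦋0⦌ := (nerve E).δ 1 ((nerve E).δ 2 S)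
  let y : (nerve E) _⦋0⦌ := (nerve E).δ 0 ((nerve E).δ 2 S)
  have hy : (nerve E).δ 1 ((nerve E).δ 0 S) = y :=
    map_op_congr (f := SimplexCategory.δ 1 ≫ SimplexCategory.δ 0)
      (g := SimplexCategory.δ 0 ≫ SimplexCategory.δ 2) (fun j => by
        obtain rfl := Subsingleton.elim (α := Fin 1) j 0; rfl) S
  have hx : (nerve E).δ 0 ((nerve E).δ 0 S) = x := by
    have h : (nerve E).δ 0 ((nerve E).δ 1 S) = x := by rw [h₁]; rfl
    exact h
  let e : (nerve E).Edge x y := .mk ((nerve E).δ 2 S) rfl rfl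
  let e' : (nerve E).Edge y x := .mk ((nerve E).δ 0 S) hy hx
  have hc : SSet.Edge.CompStruct e e' (.id x) := .mk S rfl rfl h₁
  have hc' : SSet.Edge.CompStruct e' e (.id y) := .mk S' h₀.symm h₂.symm (by
    rw [h₁', ← h₀, hy]; rfl)
  let i : nerveEquiv x ≅ nerveEquiv y :=
    ⟨nerve.homEquiv e, nerve.homEquiv e', (nerve.homEquiv_comp hc).trans (nerve.homEquiv_id x),
      (nerve.homEquiv_comp hc').trans (nerve.homEquiv_id y)⟩
  have he : ComposableArrows.mk₁ i.hom = (nerve E).δ 2 S :=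
    congrArg SSet.Edge.edge (nerve.homEquiv.symm_apply_apply e)
  have he' : ComposableArrows.mk₁ i.inv = (nerve E).δ 0 S :=
    congrArg SSet.Edge.edge (nerve.homEquiv.symm_apply_apply e')
  have hext : ∀ T T' : (nerve E) _⦋2⦌, (nerve E).δ 2 T = (nerve E).δ 2 T' →
      (nerve E).δ 0 T = (nerve E).δ 0 T' → T = T' := fun T T' h2 h0 => by
    refine (Nerve.strictSegal E).spineInjective (SSet.Path.ext' fun k => ?_)
    obtain rfl | rfl := Fin.exists_fin_two.1 ⟨k, rfl⟩
    · refine (map_op_congr (f := SimplexCategory.mkOfSucc 0) (g := SimplexCategory.δ 2)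
        (fun j => ?_) T).trans (h2.trans (map_op_congr (fun j => ?_) T')) <;>
      obtain rfl | rfl := Fin.exists_fin_two.1 ⟨j, rfl⟩ <;> rfl
    · refine (map_op_congr (f := SimplexCategory.mkOfSucc 1) (g := SimplexCategory.δ 0)
        (fun j => ?_) T).trans (h0.trans (map_op_congr (fun j => ?_) T')) <;>
      obtain rfl | rfl := Fin.exists_fin_two.1 ⟨j, rfl⟩ <;> rfl
  have hm : ∀ T : ComposableArrows E 1, T = ComposableArrows.mk₁ (T.map' 0 1) := fun T =>
    (ComposableArrows.mk₁_hom T).symm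
  refine ⟨WalkingIso.fromIso i, hext _ _ (Eq.trans ?_ he) (Eq.trans ?_ he'),
    hext _ _ (Eq.trans ?_ (he'.trans h₀)) (Eq.trans ?_ (he.trans h₂))⟩
  all_goals exact hm _

end WalkingIso

/-! ### Points of the space of isomorphisms as compatible families -/

section Diagrams

variable {D : Type u} [Category.{u} D]

variable (D) in
/-- The nerve of the maximal subgroupoid of the category of isomorphisms in `D`. -/
abbrev isoNerve : SSet.{u} := nerve (Core (WalkingIso.{u} ⥤ D))

/-- Precomposition with a chain of arrows of the free-living isomorphism. -/
def evalChain {n : SimplexCategory} (k : ComposableArrows WalkingIso.{u} n.len) :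
    isoNerve D ⟶ diagNerve D n :=
  nerveMap ((Functor.whiskeringLeft _ _ D).obj k).core

theorem evalChain_map {m n : SimplexCategory} (f : m ⟶ n) (k : SSet.coherentIso.{u}.obj (op n)) :
    evalChain (D := D) (SSet.coherentIso.map f.op k) = evalChain k ≫ diagMap f := rfl

instance : Finite WalkingIso.{u} := Finite.of_equiv _ WalkingIso.equivBool.symm

/-- The edges of E see all objects and arrows of a diagram. There are finitely many of them, as the
continuity test requires. -/
theorem jointlyInjective_evalChain : JointlyInjective
    fun ij : WalkingIso.{u} × WalkingIso.{u} =>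
      evalChain (D := D) (n := ⦋1⦌) (isoChain ![ij.1, ij.2]) := by
  intro p σ τ h
  refine transpose_injective (Functor.hext (fun i => ?_) fun i j f => ?_)
  · exact Functor.congr_obj (congrArg transpose (h (i, i))) (0 : Fin 2)
  · exact Functor.hcongr_hom (congrArg transpose (h (i, j))) (homOfLE (Fin.zero_le (1 : Fin 2)))

/-- Compatible families of points of the classifying diagram which are indexed by the simplices of
the nerve of the free-living isomorphism. -/
theorem exists_eval_eq
    (y : ∀ n : SimplexCategory, SSet.coherentIso.{u}.obj (op n) → SSet.toTop.obj (diagNerve D n))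
    (hy : ∀ {m n : SimplexCategory} (f : m ⟶ n) (k : SSet.coherentIso.{u}.obj (op n)),
      y m (SSet.coherentIso.map f.op k) = SSet.toTop.map (diagMap f) (y n k)) :
    ∃ a : SSet.toTop.obj (isoNerve D), ∀ n k, SSet.toTop.map (evalChain k) a = y n k := by
  -- The two round trips contain the data of an isomorphism and its inverse laws; over a common
  -- interior `u` their compatibility is one of simplices.
  obtain ⟨p, u, σ, σ', hu, hσ, hσ'⟩ := exists_common_pt₂ (y ⦋2⦌ (roundTrip .zero .one))
    (y ⦋2⦌ (roundTrip .one .zero))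
  have key : ∀ {m n : SimplexCategory} {f : m ⟶ n} {k : SSet.coherentIso.{u}.obj (op n)}
      {τ : (diagNerve D n).obj (op p)}, pt τ u = y n k →
      pt ((diagMap f).app (op p) τ) u = y m (SSet.coherentIso.map f.op k) :=
    fun {m n f k τ} h => by rw [hy, ← h, toTop_map_pt]
  have inj : ∀ {m n n' : SimplexCategory} {f : m ⟶ n} {f' : m ⟶ n'}
      {k : SSet.coherentIso.{u}.obj (op n)} {k' : SSet.coherentIso.{u}.obj (op n')}
      {τ : (diagNerve D n).obj (op p)} {τ' : (diagNerve D n').obj (op p)},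
      pt τ u = y n k → pt τ' u = y n' k' →
      SSet.coherentIso.map f.op k = SSet.coherentIso.map f'.op k' →
      (nerve (Family (Fin (p.len + 1)) D)).map f.op (transpose τ) =
        (nerve (Family (Fin (p.len + 1)) D)).map f'.op (transpose τ') :=
    fun {m n n' f f' k k' τ τ'} h h' e =>
      congrArg transpose (pt_injective hu ((key h).trans ((congrArg (y m) e).trans (key h').symm)))
  have hE : ∀ {n : SimplexCategory} {k k' : SSet.coherentIso.{u}.obj (op n)},
      (∀ i, k.obj i = k'.obj i) → k = k' := fun h => nerve.ext_of_isThin (funext h)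
  have hdeg : ∀ {i j : WalkingIso.{u}} {τ}, pt τ u = y ⦋2⦌ (roundTrip i j) →
      (nerve (Family (Fin (p.len + 1)) D)).δ 1 (transpose τ) =
      (nerve (Family (Fin (p.len + 1)) D)).σ 0 ((nerve (Family (Fin (p.len + 1)) D)).δ 1
        ((nerve (Family (Fin (p.len + 1)) D)).δ 2 (transpose τ))) := fun {i j τ} h => by
    refine inj (f' := SimplexCategory.σ 0 ≫ SimplexCategory.δ 1 ≫ SimplexCategory.δ 2) h h
      (hE fun l => ?_)
    obtain rfl | rfl := Fin.exists_fin_two.1 ⟨l, rfl⟩ <;> rfl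
  obtain ⟨Φ, h, h'⟩ := exists_walkingIso_functor (transpose σ) (transpose σ')
    (inj hσ hσ' (hE fun l => by obtain rfl | rfl := Fin.exists_fin_two.1 ⟨l, rfl⟩ <;> rfl))
    (inj hσ hσ' (hE fun l => by obtain rfl | rfl := Fin.exists_fin_two.1 ⟨l, rfl⟩ <;> rfl))
    (hdeg hσ) (hdeg hσ')
  let a : SSet.toTop.obj (isoNerve D) := pt (n := p) (untranspose Φ) u
  have ha : SSet.toTop.map (evalChain (n := ⦋2⦌) (roundTrip .zero .one)) a =
      y ⦋2⦌ (roundTrip .zero .one) := by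
    refine (toTop_map_pt _ _ _).trans (Eq.trans ?_ hσ)
    exact congrArg (pt · u) (transpose_injective h)
  have ha' : SSet.toTop.map (evalChain (n := ⦋2⦌) (roundTrip .one .zero)) a =
      y ⦋2⦌ (roundTrip .one .zero) := by
    refine (toTop_map_pt _ _ _).trans (Eq.trans ?_ hσ')
    exact congrArg (pt · u) (transpose_injective h')
  have step : ∀ {m n : SimplexCategory} (f : m ⟶ n) (k : SSet.coherentIso.{u}.obj (op n)),
      SSet.toTop.map (evalChain k) a = y n k →
      SSet.toTop.map (evalChain (D := D) (SSet.coherentIso.map f.op k)) a =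
        y m (SSet.coherentIso.map f.op k) := fun f k h => by
    rw [hy, ← h, evalChain_map, toTop_map_comp]
  have edge : ∀ k : SSet.coherentIso.{u}.obj (op ⦋1⦌),
      SSet.toTop.map (evalChain (n := ⦋1⦌) k) a = y ⦋1⦌ k := fun k => by
    have : ∀ (f : ⦋1⦌ ⟶ ⦋2⦌) (s : SSet.coherentIso.{u}.obj (op ⦋2⦌)),
        SSet.toTop.map (evalChain (n := ⦋2⦌) s) a = y ⦋2⦌ s →
        (∀ i, k.obj i = s.obj (f i)) →
        SSet.toTop.map (evalChain (n := ⦋1⦌) k) a = y ⦋1⦌ k := fun f s hs hk => by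
      rw [show k = SSet.coherentIso.map f.op s from hE hk]
      exact step f s hs
    -- Each of the four edges of E is a face of one of the two round trips.
    rcases h0 : k.obj (0 : Fin 2) with ⟨⟨_ | _⟩⟩ <;> rcases h1 : k.obj (1 : Fin 2) with ⟨⟨_ | _⟩⟩
    · refine this (SimplexCategory.δ 1) _ ha fun l => ?_
      obtain rfl | rfl := Fin.exists_fin_two.1 ⟨l, rfl⟩
      exacts [h0, h1]
    · refine this (SimplexCategory.δ 2) _ ha fun l => ?_
      obtain rfl | rfl := Fin.exists_fin_two.1 ⟨l, rfl⟩
      exacts [h0, h1]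
    · refine this (SimplexCategory.δ 0) _ ha fun l => ?_
      obtain rfl | rfl := Fin.exists_fin_two.1 ⟨l, rfl⟩
      exacts [h0, h1]
    · refine this (SimplexCategory.δ 1) _ ha' fun l => ?_
      obtain rfl | rfl := Fin.exists_fin_two.1 ⟨l, rfl⟩
      exacts [h0, h1]
  have pos : ∀ (n : ℕ) (k : SSet.coherentIso.{u}.obj (op ⦋n + 1⦌)),
      SSet.toTop.map (evalChain (n := ⦋n + 1⦌) k) a = y ⦋n + 1⦌ k := fun n k => by
    refine (jointlyInjective_spine (D := D) n).eq fun i => ?_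
    rw [← hy, ← edge, evalChain_map, toTop_map_comp]
  refine ⟨a, fun n k => ?_⟩
  -- Spines give no information in degree 0, so every simplex is treated as a face of its own
  -- degeneracy, which has positive degree.
  obtain ⟨k', rfl⟩ : ∃ k', SSet.coherentIso.{u}.map (SimplexCategory.δ 0 :
      ⦋n.len⦌ ⟶ ⦋n.len + 1⦌).op k' = k :=
    ⟨(SSet.coherentIso.{u}.σ (n := n.len) 0 k),
      (congrArg (fun f => f k) (SSet.coherentIso.{u}.δ_comp_σ_self (n := n.len) (i := 0)))⟩
  exact step _ _ (pos _ _)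

end Diagrams

/-! ### Contraction of diagrams of isomorphisms to constant diagrams -/

section Pairing

open CartesianMonoidalCategory MonoidalCategory

variable {K L : SSet.{u}}

theorem exists_pair (x : SSet.toTop.obj K) (y : SSet.toTop.obj L) :
    ∃ z : SSet.toTop.obj (K ⊗ L), SSet.toTop.map (fst K L) z = x ∧
      SSet.toTop.map (snd K L) z = y := by
  obtain ⟨h, -, h₁, h₂⟩ := exists_prod_lift (S := Unit) (continuous_const (y := x))
    (continuous_const (y := y))
  exact ⟨h (), h₁ (), h₂ ()⟩

/-- The point of the realization of a product with given projections. -/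
def pair (x : SSet.toTop.obj K) (y : SSet.toTop.obj L) : SSet.toTop.obj (K ⊗ L) :=
  (exists_pair x y).choose

theorem fst_pair (x : SSet.toTop.obj K) (y : SSet.toTop.obj L) :
    SSet.toTop.map (fst K L) (pair x y) = x := (exists_pair x y).choose_spec.1

theorem snd_pair (x : SSet.toTop.obj K) (y : SSet.toTop.obj L) :
    SSet.toTop.map (snd K L) (pair x y) = y := (exists_pair x y).choose_spec.2

theorem pair_pt {n : SimplexCategory} (σ : K.obj (op n)) (τ : L.obj (op n)) (t : TopSimplex n) :
    pair (pt σ t) (pt τ t) = pt (K := K ⊗ L) (n := n) (σ, τ) t :=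
  prod_ext ((fst_pair _ _).trans (toTop_map_pt (fst K L) (n := n) (σ, τ) t).symm)
    ((snd_pair _ _).trans (toTop_map_pt (snd K L) (n := n) (σ, τ) t).symm)

theorem continuous_pair {S : Type*} [TopologicalSpace S] [CompactSpace S]
    {f : S → SSet.toTop.obj K} {g : S → SSet.toTop.obj L} (hf : Continuous f)
    (hg : Continuous g) : Continuous fun s => pair (f s) (g s) := by
  obtain ⟨h, hh, h₁, h₂⟩ := exists_prod_lift hf hg
  exact hh.congr fun s => prod_ext ((h₁ s).trans (fst_pair _ _).symm)
    ((h₂ s).trans (snd_pair _ _).symm)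

end Pairing

/-! ### The homotopy from diagrams of isomorphisms to constant diagrams -/

section Contraction

open CartesianMonoidalCategory MonoidalCategory

variable {D : Type u} [Category.{u} D]

/-- The endofunctors of the free-living isomorphism which contract it to one object: the identity
for the first object and a constant functor for the second one. -/
def contractor (j : WalkingIso.{u}) : WalkingIso.{u} ⥤ WalkingIso.{u} where
  obj i := WalkingIso.rec (motive := fun _ => WalkingIso.{u}) i .zero j
  map _ := ()

variable (D) in
/-- Restriction of diagrams along the functors `contractor`. -/
def contractFunctor : Core (WalkingIso.{u} ⥤ D) × WalkingIso.{u} ⥤ Core (WalkingIso.{u} ⥤ D) where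
  obj F := ⟨contractor F.2 ⋙ F.1.of⟩
  map {F F'} α := ⟨NatIso.ofComponents
    (fun i => F.1.of.mapIso (Codiscrete.iso ((contractor F.2).obj i) ((contractor F'.2).obj i)) ≪≫
      α.1.iso.app _) fun {i j} f => by
        have h := α.1.iso.hom.naturality ((contractor F'.2).map f)
        simp only [Functor.comp_map, Iso.trans_hom, Functor.mapIso_hom, Iso.app_hom,
          Category.assoc, ← h]
        simp only [← Category.assoc, ← Functor.map_comp]
        rfl⟩
  map_id F := Core.hom_ext (NatTrans.ext (funext fun i =>
    (Category.comp_id _).trans (F.1.of.map_id _)))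
  map_comp {F F' F''} α β := Core.hom_ext (NatTrans.ext (funext fun i => by
    have h := α.1.iso.hom.naturality
      (Codiscrete.iso ((contractor F'.2).obj i) ((contractor F''.2).obj i)).hom
    change F.1.of.map _ ≫ α.1.iso.hom.app _ ≫ β.1.iso.hom.app _ =
      (F.1.of.map _ ≫ α.1.iso.hom.app _) ≫ F'.1.of.map _ ≫ β.1.iso.hom.app _
    rw [Category.assoc, ← Category.assoc (α.1.iso.hom.app _), ← h]
    simp only [← Category.assoc, ← Functor.map_comp]
    rfl))

variable (D) in
/-- The homotopy from the identity to the restriction to constant diagrams. -/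
def contractMap : isoNerve D ⊗ SSet.coherentIso.{u} ⟶ isoNerve D where
  app n := ↾fun (z : (isoNerve D).obj n × SSet.coherentIso.{u}.obj n) =>
    (Functor.prod' z.1 z.2 ⋙ contractFunctor D : ComposableArrows _ _)
  naturality _ _ _ := rfl

theorem map_id_comp {J : Type*} [Category* J] (F : J ⥤ D) (k : J) {d : D} (g : F.obj k ⟶ d) :
    F.map (𝟙 k) ≫ g = g := by
  rw [F.map_id, Category.id_comp]

/-- The constant chain of arrows of the free-living isomorphism. -/
def constChain (n : SimplexCategory) (i : WalkingIso.{u}) : SSet.coherentIso.{u}.obj (op n) :=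
  isoChain fun _ => i

theorem contractMap_zero {n : SimplexCategory} (σ : (isoNerve D).obj (op n)) :
    (contractMap D).app (op n) (σ, constChain n .zero) = σ := by
  refine Functor.hext (fun _ => rfl) fun i j f => heq_of_eq ?_
  refine Core.hom_ext (NatTrans.ext (funext fun k => ?_))
  exact map_id_comp (σ.obj i).of _ _

theorem contractMap_one {n : SimplexCategory} (σ : (isoNerve D).obj (op n)) :
    (contractMap D).app (op n) (σ, constChain n .one) =
      (nerveMap ((Functor.whiskeringLeft _ _ D).obj (contractor .one)).core).app (op n) σ := by
  refine Functor.hext (fun _ => rfl) fun i j f => heq_of_eq ?_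
  refine Core.hom_ext (NatTrans.ext (funext fun k => ?_))
  exact map_id_comp (σ.obj i).of _ _

variable (D) in
/-- The inclusion of the constant diagrams. -/
def constDiagram : diagNerve D ⦋0⦌ ⟶ isoNerve D :=
  nerveMap ((Functor.whiskeringLeft _ _ D).obj
    ({ obj := fun _ => 0, map := fun _ => 𝟙 _ } : WalkingIso.{u} ⥤ Fin 1)).core

theorem constDiagram_evalChain {n : SimplexCategory}
    (k : ComposableArrows WalkingIso.{u} n.len) :
    constDiagram D ≫ evalChain k = diagMap (SimplexCategory.const n ⦋0⦌ 0) := rfl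

/-- Constant diagrams send all arrows to identities, so the homotopy is stationary on them. -/
theorem contractMap_constDiagram {n : SimplexCategory} (σ : (diagNerve D ⦋0⦌).obj (op n))
    (κ : SSet.coherentIso.{u}.obj (op n)) :
    (contractMap D).app (op n) ((constDiagram D).app (op n) σ, κ) =
      (constDiagram D).app (op n) σ := by
  refine Functor.hext (fun _ => rfl) fun i j f => heq_of_eq ?_
  refine Core.hom_ext (NatTrans.ext (funext fun k => ?_))
  exact map_id_comp (σ.obj i).of _ _

/-- Postcomposition with a functor. -/
def isoNerveMap {D' : Type u} [Category.{u} D'] (F : D ⥤ D') : isoNerve D ⟶ isoNerve D' :=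
  nerveMap ((Functor.whiskeringRight WalkingIso.{u} _ _).obj F).core

/-- The homotopy only changes the indexing category. Applied to the functors by which G acts, this
keeps the H-fixed points inside themselves. -/
theorem contractMap_isoNerveMap {D' : Type u} [Category.{u} D'] (F : D ⥤ D') {n : SimplexCategory}
    (σ : (isoNerve D).obj (op n)) (κ : SSet.coherentIso.{u}.obj (op n)) :
    (contractMap D').app (op n) ((isoNerveMap F).app (op n) σ, κ) =
      (isoNerveMap F).app (op n) ((contractMap D).app (op n) (σ, κ)) := by
  refine Functor.hext (fun _ => rfl) fun i j f => heq_of_eq ?_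
  refine Core.hom_ext (NatTrans.ext (funext fun k => ?_))
  exact (F.map_comp _ _).symm

/-- The canonical path in the realization of the nerve of the free-living isomorphism. -/
def isoPath (t : unitInterval) : SSet.toTop.obj SSet.coherentIso.{u} :=
  pt (n := ⦋1⦌) (isoChain ![.zero, .one] : ComposableArrows WalkingIso.{u} 1)
    ⟨![1 - t, t], fun i => by
      obtain rfl | rfl := Fin.exists_fin_two.1 ⟨i, rfl⟩
      exacts [sub_nonneg.2 t.2.2, t.2.1], by
      change ∑ i : Fin 2, _ = _
      rw [Fin.sum_univ_two]
      exact sub_add_cancel (1 : ℝ) t⟩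

theorem continuous_isoPath : Continuous isoPath.{u} := by
  refine (continuous_pt _).comp (Continuous.subtype_mk (continuous_pi fun i => ?_) _)
  obtain rfl | rfl := Fin.exists_fin_two.1 ⟨i, rfl⟩
  exacts [continuous_const.sub continuous_subtype_val, continuous_subtype_val]

theorem pt_constChain {n : SimplexCategory} (i : WalkingIso.{u}) (u : TopSimplex n) :
    pt (constChain n i) u =
      pt (constChain ⦋0⦌ i) (TopSimplex.map (SimplexCategory.const n ⦋0⦌ 0) u) :=
  pt_map (SimplexCategory.const n ⦋0⦌ 0) (constChain ⦋0⦌ i) u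

theorem map_vertexHom_apply {n : SimplexCategory} (v : TopSimplex ⦋0⦌) (i j : Fin (n.len + 1)) :
    TopSimplex.map (vertexHom n i) v j = if i = j then 1 else 0 := by
  have hv : ∑ k : Fin 1, v k = 1 := v.2.2
  rw [TopSimplex.map_apply]
  split_ifs with h
  · exact (Finset.sum_congr (Finset.filter_true_of_mem fun _ _ => h) fun _ _ => rfl).trans hv
  · exact (Finset.sum_congr (Finset.filter_false_of_mem fun _ _ => h) fun _ _ => rfl).trans
      Finset.sum_empty

/-- The arbitrary `u` allows the end point to be paired, by `pair_pt`, with a point given over any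
simplex. -/
theorem isoPath_zero {n : SimplexCategory} (u : TopSimplex n) :
    isoPath.{u} 0 = pt (constChain n .zero) u := by
  refine Eq.trans (congrArg (pt _) (Subtype.ext (funext fun j => ?_)))
    ((pt_map (vertexHom ⦋1⦌ 0) _ _).symm.trans (pt_constChain .zero u).symm)
  refine Eq.trans ?_ (map_vertexHom_apply _ _ _).symm
  obtain rfl | rfl := Fin.exists_fin_two.1 ⟨j, rfl⟩
  exacts [sub_zero 1, rfl]

theorem isoPath_one {n : SimplexCategory} (u : TopSimplex n) :
    isoPath.{u} 1 = pt (constChain n .one) u := by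
  refine Eq.trans (congrArg (pt _) (Subtype.ext (funext fun j => ?_)))
    ((pt_map (vertexHom ⦋1⦌ 1) _ _).symm.trans (pt_constChain .one u).symm)
  refine Eq.trans ?_ (map_vertexHom_apply _ _ _).symm
  obtain rfl | rfl := Fin.exists_fin_two.1 ⟨j, rfl⟩
  exacts [sub_self 1, rfl]

/-- The deformation of diagrams of isomorphisms to constant diagrams. -/
def contract (a : SSet.toTop.obj (isoNerve D)) (t : unitInterval) : SSet.toTop.obj (isoNerve D) :=
  SSet.toTop.map (contractMap D) (pair a (isoPath t))

theorem continuous_contract {S : Type*} [TopologicalSpace S] [CompactSpace S]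
    {f : S → SSet.toTop.obj (isoNerve D)} (hf : Continuous f) {t : S → unitInterval}
    (ht : Continuous t) : Continuous fun s => contract (f s) (t s) :=
  (SSet.toTop.map (contractMap D)).hom.continuous.comp
    (continuous_pair hf (continuous_isoPath.comp ht))

theorem contract_zero (a : SSet.toTop.obj (isoNerve D)) : contract a 0 = a := by
  obtain ⟨n, σ, u, rfl⟩ := exists_pt a
  rw [contract, isoPath_zero u, pair_pt]
  exact (toTop_map_pt _ _ _).trans (congrArg (pt · u) (contractMap_zero σ))

theorem contract_one (a : SSet.toTop.obj (isoNerve D)) : contract a 1 =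
    SSet.toTop.map (nerveMap ((Functor.whiskeringLeft _ _ D).obj (contractor .one)).core) a := by
  obtain ⟨n, σ, u, rfl⟩ := exists_pt a
  rw [contract, isoPath_one u, pair_pt]
  exact (toTop_map_pt _ _ _).trans ((congrArg (pt · u) (contractMap_one σ)).trans
    (toTop_map_pt _ _ _).symm)

theorem contract_constDiagram (b : SSet.toTop.obj (diagNerve D ⦋0⦌)) (t : unitInterval) :
    contract (SSet.toTop.map (constDiagram D) b) t = SSet.toTop.map (constDiagram D) b := by
  obtain ⟨n, u, σ, κ, -, rfl, h⟩ := exists_common_pt₂ b (isoPath t)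
  rw [contract, ← h, toTop_map_pt, pair_pt]
  exact (toTop_map_pt _ _ _).trans (congrArg (pt · u) (contractMap_constDiagram σ κ))

theorem contract_isoNerveMap {D' : Type u} [Category.{u} D'] (F : D ⥤ D')
    (a : SSet.toTop.obj (isoNerve D)) (t : unitInterval) :
    contract (SSet.toTop.map (isoNerveMap F) a) t =
      SSet.toTop.map (isoNerveMap F) (contract a t) := by
  obtain ⟨n, u, σ, κ, -, rfl, h⟩ := exists_common_pt₂ a (isoPath t)
  rw [contract, contract, ← h, toTop_map_pt, pair_pt, pair_pt]
  exact (toTop_map_pt _ _ _).trans ((congrArg (pt · u) (contractMap_isoNerveMap F σ κ)).trans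
    ((congrArg _ (toTop_map_pt _ _ _)).trans (toTop_map_pt _ _ _)).symm)

end Contraction

/-! ### Maps from orbits -/

section Orbit

open scoped CompactCoherentification

variable {G : Type u} [Group G] {H : Subgroup G} {K : SSet.{u}} {X : SimplicialGSpace G}

/-- The value of a map from `G/H × K` at a simplex of `K` and the base point of `G/H`. -/
def baseValue (φ : orbitTensor H K ⟶ X) (m : SimplexCategoryᵒᵖ) (k : K.obj m) : (X.obj m).V :=
  GTop.map (φ.app m) (show OrbitProd H (K.obj m) from (((1 : G) : G ⧸ H), k))

theorem apply_eq_smul_baseValue (φ : orbitTensor H K ⟶ X) (m : SimplexCategoryᵒᵖ) (g : G)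
    (k : K.obj m) : GTop.map (φ.app m) (show OrbitProd H (K.obj m) from ((g : G ⧸ H), k)) =
      g • baseValue φ m k := by
  refine Eq.trans ?_ (GTop.map_smul (φ.app m) g _)
  refine congrArg (GTop.map (φ.app m)) (Prod.ext ?_ rfl)
  exact congrArg (QuotientGroup.mk (s := H)) (mul_one g).symm

theorem smul_baseValue (φ : orbitTensor H K ⟶ X) (m : SimplexCategoryᵒᵖ) {h : G} (hh : h ∈ H)
    (k : K.obj m) : h • baseValue φ m k = baseValue φ m k := by
  rw [← apply_eq_smul_baseValue, baseValue]
  refine congrArg (GTop.map (φ.app m)) (Prod.ext ?_ rfl)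
  exact QuotientGroup.eq.2 (by simpa using hh)

theorem baseValue_map (φ : orbitTensor H K ⟶ X) {m m' : SimplexCategoryᵒᵖ} (f : m ⟶ m')
    (k : K.obj m) : baseValue φ m' (K.map f k) = GTop.map (X.map f) (baseValue φ m k) := by
  have h : ∀ x : OrbitProd H (K.obj m), GTop.map (φ.app m') (GTop.map (orbitMap H (K.map f)) x) =
      GTop.map (X.map f) (GTop.map (φ.app m) x) := fun x =>
    ConcreteCategory.congr_hom (congrArg Action.Hom.hom (φ.naturality f)) x
  exact h (((1 : G) : G ⧸ H), k)

theorem orbitHom_ext {φ ψ : orbitTensor H K ⟶ X}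
    (h : ∀ (n : SimplexCategory) k, baseValue φ (op n) k = baseValue ψ (op n) k) : φ = ψ := by
  refine NatTrans.ext (funext fun m => Action.hom_ext _ _ (TopCat.hom_ext
    (ContinuousMap.ext fun x => ?_)))
  obtain ⟨x, k⟩ := (x : OrbitProd H (K.obj m))
  obtain ⟨g, rfl⟩ := QuotientGroup.mk_surjective x
  exact (apply_eq_smul_baseValue φ m g k).trans
    ((congrArg (g • ·) (h m.unop k)).trans (apply_eq_smul_baseValue ψ m g k).symm)

/-- Compatible families of `H`-fixed points are maps from `G/H × K`. -/
def orbitHom (y : ∀ m, K.obj m → (X.obj m).V)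
    (hy : ∀ (m m' : SimplexCategoryᵒᵖ) (f : m ⟶ m') (k : K.obj m),
      y m' (K.map f k) = GTop.map (X.map f) (y m k))
    (hH : ∀ h ∈ H, ∀ m k, h • y m k = y m k) : orbitTensor H K ⟶ X where
  app m := GTop.homMk (A := GTop.of (OrbitProd H (K.obj m)))
    (⟨fun x : OrbitProd H (K.obj m) => Quotient.liftOn' x.1 (fun g => g • y m x.2) fun a b hab => by
      have h := hH _ (QuotientGroup.leftRel_apply.1 hab) m x.2
      rw [mul_smul, inv_smul_eq_iff] at h
      exact h.symm, continuous_of_discreteTopology⟩ : C(OrbitProd H (K.obj m), (X.obj m).V))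
    fun g x => by
      obtain ⟨x, k⟩ := (x : OrbitProd H (K.obj m))
      obtain ⟨a, rfl⟩ := QuotientGroup.mk_surjective x
      exact mul_smul g a (y m k)
  naturality m m' f := by
    refine Action.hom_ext _ _ (TopCat.hom_ext (ContinuousMap.ext fun x => ?_))
    obtain ⟨x, k⟩ := (x : OrbitProd H (K.obj m))
    obtain ⟨a, rfl⟩ := QuotientGroup.mk_surjective x
    exact (congrArg (a • ·) (hy m m' f k)).trans (GTop.map_smul (X.map f) a _).symm

theorem baseValue_orbitHom (y : ∀ m, K.obj m → (X.obj m).V)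
    (hy : ∀ (m m' : SimplexCategoryᵒᵖ) (f : m ⟶ m') (k : K.obj m),
      y m' (K.map f k) = GTop.map (X.map f) (y m k))
    (hH : ∀ h ∈ H, ∀ m k, h • y m k = y m k) (m) (k : K.obj m) :
    baseValue (orbitHom y hy hH) m k = y m k := one_smul G (y m k)

/-- Continuity of maps from compact spaces to the mapping space. -/
theorem continuous_mapSpace_iff {S : Type*} [TopologicalSpace S] [CompactSpace S]
    {φ : S → 𝐤 (MapSpace (orbitTensor H K) X)} : Continuous φ ↔ ∀ m k, Continuous fun s =>
      baseValue ((CompactCoherentification.mk (MapSpace (orbitTensor H K) X)).symm (φ s)) m k := by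
  rw [continuous_coherent_iff]
  refine ⟨fun h m k => ?_, fun h => continuous_induced_rng.2 (continuous_pi fun m => ?_)⟩
  · exact (continuous_eval_const _).comp ((continuous_mapSpace_apply m).comp h)
  -- G/H × K_m is discrete, so joint continuity is continuity at each of its points, and
  -- equivariance reduces these to the base coset.
  · refine ContinuousMap.continuous_of_continuous_uncurry
      (X := S) (Y := OrbitProd H (K.obj m)) _ (continuous_prod_of_discrete_right.2 ?_)
    rintro ⟨x, k⟩
    obtain ⟨g, rfl⟩ := QuotientGroup.mk_surjective x
    exact ((h m k).const_smul g).congr fun s => (apply_eq_smul_baseValue _ m g k).symm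

end Orbit

/-! ### Completeness of the classifying diagram -/

section Complete

open scoped CompactCoherentification

variable {G : Type u} [Group G] (C : Action Cat.{u, u} G) {H : Subgroup G}

/-- The action of `G` on diagrams of isomorphisms. -/
def isoNerveAct (g : G) : isoNerve C.V ⟶ isoNerve C.V := isoNerveMap (C.ρ g).toFunctor

theorem smul_evalChain (g : G) {n : SimplexCategory} (k : ComposableArrows WalkingIso.{u} n.len)
    (a : SSet.toTop.obj (isoNerve C.V)) :
    g • (show ((classifyingDiagram C).obj (op n)).V from SSet.toTop.map (evalChain k) a) =
      SSet.toTop.map (evalChain k) (SSet.toTop.map (isoNerveAct C g) a) :=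
  (toTop_map_comp (evalChain k)
    (nerveMap ((C.ρ g).toFunctor.mapComposableArrows n.len).core) a).symm.trans
    (toTop_map_comp (isoNerveAct C g) (evalChain k) a)

variable {C}

theorem eq_of_evalChain {a b : SSet.toTop.obj (isoNerve C.V)}
    (h : ∀ k, SSet.toTop.map (evalChain (n := ⦋1⦌) k) a =
      SSet.toTop.map (evalChain (n := ⦋1⦌) k) b) : a = b :=
  jointlyInjective_evalChain.eq fun _ => h _

theorem exists_iso_point (φ : orbitTensor H SSet.coherentIso.{u} ⟶ classifyingDiagram C) :
    ∃ a : SSet.toTop.obj (isoNerve C.V), ∀ (n : SimplexCategory) (k),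
      SSet.toTop.map (evalChain k) a = baseValue φ (op n) k :=
  exists_eval_eq (fun n k => baseValue φ (op n) k) fun f k => baseValue_map φ f.op k

/-- The point of the realization of the nerve of diagrams of isomorphisms which belongs to a map
from `G/H × E`. -/
def isoPoint (φ : orbitTensor H SSet.coherentIso.{u} ⟶ classifyingDiagram C) :
    SSet.toTop.obj (isoNerve C.V) := (exists_iso_point φ).choose

theorem evalChain_isoPoint (φ : orbitTensor H SSet.coherentIso.{u} ⟶ classifyingDiagram C)
    (n : SimplexCategory) (k) :
    SSet.toTop.map (evalChain k) (isoPoint φ) = baseValue φ (op n) k :=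
  (exists_iso_point φ).choose_spec n k

theorem isoNerveAct_isoPoint (φ : orbitTensor H SSet.coherentIso.{u} ⟶ classifyingDiagram C)
    {h : G} (hh : h ∈ H) : SSet.toTop.map (isoNerveAct C h) (isoPoint φ) = isoPoint φ :=
  eq_of_evalChain fun k => by
    rw [← smul_evalChain, evalChain_isoPoint]
    exact smul_baseValue φ _ hh k

/-- Points fixed by `H` give maps from `G/H × E`. -/
def ofIsoPoint (a : SSet.toTop.obj (isoNerve C.V))
    (ha : ∀ h ∈ H, SSet.toTop.map (isoNerveAct C h) a = a) :
    orbitTensor H SSet.coherentIso.{u} ⟶ classifyingDiagram C :=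
  orbitHom (X := classifyingDiagram C) (fun m k => SSet.toTop.map (evalChain (n := m.unop) k) a)
    (fun m _ f k => toTop_map_comp (evalChain (n := m.unop) k) (diagMap f.unop) a)
    fun h hh _ k => (smul_evalChain C h k a).trans (congrArg _ (ha h hh))

theorem baseValue_ofIsoPoint (a : SSet.toTop.obj (isoNerve C.V))
    (ha : ∀ h ∈ H, SSet.toTop.map (isoNerveAct C h) a = a) (n : SimplexCategory) (k) :
    baseValue (ofIsoPoint a ha) (op n) k = SSet.toTop.map (evalChain (n := n) k) a :=
  baseValue_orbitHom (X := classifyingDiagram C) _ _ _ _ _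

/-- The deformation of the space of maps from `G/H × E` to the maps which factor through `G/H`. -/
def contractHom (φ : orbitTensor H SSet.coherentIso.{u} ⟶ classifyingDiagram C)
    (t : unitInterval) : orbitTensor H SSet.coherentIso.{u} ⟶ classifyingDiagram C :=
  ofIsoPoint (contract (isoPoint φ) t) fun _ hh =>
    (contract_isoNerveMap _ _ _).symm.trans (congrArg (contract · t) (isoNerveAct_isoPoint φ hh))

theorem baseValue_contractHom (φ : orbitTensor H SSet.coherentIso.{u} ⟶ classifyingDiagram C)
    (t : unitInterval) (n : SimplexCategory) (k) : baseValue (contractHom φ t) (op n) k =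
      SSet.toTop.map (evalChain (n := n) k) (contract (isoPoint φ) t) :=
  baseValue_ofIsoPoint _ _ _ _

theorem contractHom_zero (φ : orbitTensor H SSet.coherentIso.{u} ⟶ classifyingDiagram C) :
    contractHom φ 0 = φ :=
  orbitHom_ext fun n k => by
    rw [baseValue_contractHom, contract_zero]
    exact evalChain_isoPoint φ n k

theorem point_eq {n : SimplexCategory} (x y : (Δ[0] : SSet.{u}).obj (op n)) : x = y :=
  SSet.stdSimplex.objEquiv.injective (simplexHom_ext fun _ => Subsingleton.elim (α := Fin 1) _ _)

/-- The projection from `E` to the point. -/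
abbrev toPoint : SSet.coherentIso.{u} ⟶ Δ[0] := SSet.stdSimplex.isTerminalObj₀.from _

/-- The inclusion of the first vertex into `E`. -/
def ofPoint : Δ[0] ⟶ SSet.coherentIso.{u} := SSet.yonedaEquiv.symm (constChain ⦋0⦌ .zero)

/-- The endofunctor `contractor .one` is constant at the first object, so the end of the contraction
is restriction to the first vertex of E. -/
theorem contractHom_one (φ : orbitTensor H SSet.coherentIso.{u} ⟶ classifyingDiagram C) :
    contractHom φ 1 = orbitTensorMap H toPoint ≫ orbitTensorMap H ofPoint ≫ φ :=
  orbitHom_ext fun n k => by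
    rw [baseValue_contractHom, contract_one]
    refine (toTop_map_comp _ (evalChain (n := n) k) _).symm.trans ?_
    exact evalChain_isoPoint φ n (constChain n .zero)

theorem contractHom_toPoint (φ : orbitTensor H Δ[0] ⟶ classifyingDiagram C) (t : unitInterval) :
    contractHom (orbitTensorMap H toPoint ≫ φ) t = orbitTensorMap H toPoint ≫ φ := by
  set ψ := orbitTensorMap H toPoint ≫ φ with hψ
  let b : SSet.toTop.obj (diagNerve C.V ⦋0⦌) :=
    baseValue φ (op ⦋0⦌) (SSet.stdSimplex.objEquiv.symm (𝟙 _))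
  have hb : ∀ (n : SimplexCategory) (k),
      SSet.toTop.map (diagMap (D := C.V) (SimplexCategory.const n ⦋0⦌ 0)) b =
        baseValue ψ (op n) k := fun n k =>
    (baseValue_map φ (SimplexCategory.const n ⦋0⦌ 0).op _).symm.trans
      (congrArg (baseValue φ (op n)) (point_eq _ _))
  have ha : isoPoint ψ = SSet.toTop.map (constDiagram C.V) b := eq_of_evalChain fun k => by
    rw [evalChain_isoPoint, ← toTop_map_comp, constDiagram_evalChain]
    exact (hb ⦋1⦌ k).symm
  refine orbitHom_ext fun n k => ?_
  rw [baseValue_contractHom, ha, contract_constDiagram, ← ha]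
  exact evalChain_isoPoint ψ n k

/-- Restriction to the first vertex is a retraction, and `contractHom` deforms the identity to its
composite with the inclusion. Continuity is required on compact test spaces only, where it is
checked on the edges of E. -/
theorem isWeakEquiv_precompMap_toPoint (H : Subgroup G) :
    IsWeakEquiv (precompMap (orbitTensorMap H toPoint) (classifyingDiagram C)) := by
  have hid : orbitTensorMap H ofPoint ≫ orbitTensorMap H toPoint = 𝟙 (orbitTensor H Δ[0]) := by
    exact orbitHom_ext (X := orbitTensor H Δ[0]) fun n k => Prod.ext rfl (point_eq _ _)
  have hcont : ∀ {S : Type} [TopologicalSpace S] [CompactSpace S]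
      (g : C(S, 𝐤 (MapSpace (orbitTensor H SSet.coherentIso.{u}) (classifyingDiagram C)))),
      Continuous fun s => isoPoint
        ((CompactCoherentification.mk (MapSpace _ (classifyingDiagram C))).symm (g s)) :=
    fun g => jointlyInjective_evalChain.continuous fun ij =>
      (continuous_mapSpace_iff.1 g.continuous (op ⦋1⦌) _).congr fun s =>
        (evalChain_isoPoint _ _ _).symm
  refine isWeakEquiv_of_deformation _
    (precompMap (orbitTensorMap H ofPoint) (classifyingDiagram C))
    (fun φ t => CompactCoherentification.mk (MapSpace _ (classifyingDiagram C))
      (contractHom ((CompactCoherentification.mk (MapSpace _ (classifyingDiagram C))).symm φ) t))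
    (fun φ => ?_) (fun φ => contractHom_zero φ) (fun φ => contractHom_one φ)
    (fun φ t => contractHom_toPoint φ t) (fun g => by fun_prop) fun {S} _ _ _ g =>
      continuous_mapSpace_iff.2 fun m k => ?_
  · change orbitTensorMap H ofPoint ≫ orbitTensorMap H toPoint ≫ _ = _
    exact (Category.assoc _ _ _).symm.trans ((congrArg (· ≫ _) hid).trans (Category.id_comp _))
  · refine Continuous.congr (f := fun z : S × unitInterval =>
      SSet.toTop.map (evalChain (n := m.unop) k) (contract (isoPoint
        ((CompactCoherentification.mk (MapSpace _ (classifyingDiagram C))).symm (g z.1))) z.2))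
      ((SSet.toTop.map (evalChain (n := m.unop) k)).hom.continuous.comp
        (continuous_contract ((hcont g).comp continuous_fst) continuous_snd)) fun z => ?_
    exact (baseValue_contractHom _ _ _ _).symm

end Complete

end EquivariantSegal

end

theorem mainTheorem4 {G : Type u} [Group G] (C : Action Cat.{u, u} G) :
    ∃ _ : EquivariantSegal.IsCGHaus (EquivariantSegal.classifyingDiagram C),
      EquivariantSegal.IsCompleteSegalGSpace (EquivariantSegal.classifyingDiagram C) :=
  ⟨inferInstance,
    { toIsSegalGSpace :=
        (EquivariantSegal.isStrictSegal_classifyingDiagram C).isSegalGSpace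
      complete := EquivariantSegal.isWeakEquiv_precompMap_toPoint }⟩
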